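/- **Setting.** An *allegory* is a category $\mathcal A$ with an involution $(-)^\circ:\mathcal A^{\rm op}\to\mathcal A$ (identity on objects) and a binary operation $\wedge$ on each hom-set such that $r\le s:\Leftrightarrow r\wedge s=r$ is a partial order on each hom-set with binary infimum $\wedge$, composition is monotone, the involution preserves $\wedge$, and $(s\cdot r)\wedge t\le s\cdot(r\wedge(s^\circ\cdot t))$ always holds. A morphism $r$ is a *map* if $1\le r^\circ r$ and $rr^\circ\le 1$; the maps form a subcategory $\mathsf{Map}(\mathcal A)$. $\mathcal A$ is *tabular* if every morphism $r$ has the form $r=g f^\circ$ with maps $f,g$ satisfying $f^\circ f\wedge g^\circ g=1$; an object $E$ is a *unit* if $1_E$ is the largest element of $\mathcal A(E,E)$ and each object $A$ has a morphism $r:A\to E$ with $1_A\le r^\circ r$; $\mathcal A$ is *unitary* if it has a unit. $\mathfrak{UTabAll}$ is the 2-category whose objects are the unitary tabular allegories, whose morphisms are the functors that preserve units and commute with $(-)^\circ$ and $\wedge$, and whose 2-cells are the natural transformations $\phi:R\Rightarrow S:\mathcal A\to\mathcal B$ whose components are maps and whose naturality squares at maps of $\mathcal A$ are pullbacks in $\mathsf{Map}(\mathcal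 B)$. $\mathfrak{StabFact}$ is the 2-category whose objects $(\mathcal C,\mathcal E,\mathcal M)$ are the finitely complete categories with an (orthogonal) factorization system for which $\mathcal E$ is pullback-stable, whose morphisms $F:(\mathcal C,\mathcal E,\mathcal M)\to(\mathcal D,\mathcal F,\mathcal N)$ are the finite-limit preserving functors with $F(\mathcal E)\subseteq\mathcal F$ and $F(\mathcal M)\subseteq\mathcal N$, and whose 2-cells are the natural transformations all of whose naturality squares are pullbacks. In both, horizontal and vertical composition are those of functors and natural transformations. For $(\mathcal C,\mathcal E,\mathcal M)$ in $\mathfrak{StabFact}$, $m:X\to Y$ in $\mathcal M$, $f:A\to X$ and $s:S\to X$, the canonical morphism $A\times_XS\to A\times_YS$ from the pullback of $s$ along $f$ to the pullback of $ms$ along $mf$ is called a conjugate of $m$; $\mathcal M^*$ is the closure under pullback of the class of all conjugates of morphisms in $\mathcal M$. Let $\mathcal E_\bullet$ be the least class that contains $\mathcal E$, $\mathcal M^*$ and all isomorphisms and is closed under composition and stable under pullback. The category $\mathsf{Span}_{\mathcal E_\bullet}(\mathcal C)$ has the objects of $\mathcal C$; its morphisms $A\to B$ are the classes $[f,g]_{\mathcal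 E_\bullet}$ of spans $A\xleftarrow{f}D\xrightarrow{g}B$ under the least equivalence relation that relates $(f,g)$ and $(\tilde f,\tilde g)$ whenever $f=\tilde f x$ and $g=\tilde g x$ for some $x\in\mathcal E_\bullet$; composition is induced by the composition of spans via pullback. It carries the involution $[f,g]^\circ=[g,f]$ and the operation $[f,g]\wedge[p,q]$, represented by the product of the two spans as objects over $A\times B$, that is, by the pullback of $\langle f,g\rangle$ and $\langle p,q\rangle$. **Proposition.** There is a (strict) 2-functor $$\mathsf{All}:\mathfrak{StabFact}\longrightarrow\mathfrak{UTabAll}$$ given as follows, where all values on the right are, in particular, objects, morphisms and 2-cells of $\mathfrak{UTabAll}$: * on objects, $(\mathcal C,\mathcal E,\mathcal M)\mapsto\mathsf{Span}_{\mathcal E_\bullet}(\mathcal C)$ with the above involution and meet operation; * a morphism $F:(\mathcal C,\mathcal E,\mathcal M)\to(\mathcal D,\mathcal F,\mathcal N)$ is sent to the functor $\overline F:\mathsf{Span}_{\mathcal E_\bullet}(\mathcal C)\to\mathsf{Span}_{\mathcal F_\bullet}(\mathcal D)$ with $\overline FA=FA$ and $\overline F([f,g]_{\mathcal E_\bullet})=[Ff,Fg]_{\mathcal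 F_\bullet}$; * a 2-cell $\theta:F\Rightarrow G$ is sent to the natural transformation $\overline\theta:\overline F\Rightarrow\overline G$ with components $\overline\theta_A=[1,\theta_A]_{\mathcal F_\bullet}:FA\to GA$. -/

import Mathlib

open CategoryTheory CategoryTheory.Limits

universe v v₁ v₂ u u₁ u₂


/-! ## Allegories -/

namespace SpanAllegory

/-- The operations of an allegory on a category: `conv r` is the opposite `r°` of a morphism `r`, and
`meet r s` is the meet `r ∧ s` of two parallel morphisms. -/
class AllegoryOps (A : Type u) [Category.{v} A] where
  conv {X Y : A} : (X ⟶ Y) → (Y ⟶ X)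
  meet {X Y : A} : (X ⟶ Y) → (X ⟶ Y) → (X ⟶ Y)

section Allegory

variable {A : Type u} [Category.{v} A] [AllegoryOps A]

/-- The opposite `r°` of a morphism `r`. -/
abbrev conv {X Y : A} (r : X ⟶ Y) : Y ⟶ X := AllegoryOps.conv r

/-- The order on hom-sets induced by the meet operation: `r ≤ s` if and only if `r ∧ s = r`. -/
def Le {X Y : A} (r s : X ⟶ Y) : Prop := AllegoryOps.meet r s = r

variable (A) in
/-- The laws of an allegory. The first three say that the relation `Le` is a partial order on each
hom-set, with `meet` as binary infimum. Recall that `r ≫ s` is the composite `s · r`, so that the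
last law is the modular law `(s · r) ∧ t ≤ s · (r ∧ (s° · t))`. -/
class IsAllegory : Prop where
  meet_self {X Y : A} (r : X ⟶ Y) : AllegoryOps.meet r r = r
  meet_comm {X Y : A} (r s : X ⟶ Y) : AllegoryOps.meet r s = AllegoryOps.meet s r
  meet_assoc {X Y : A} (r s t : X ⟶ Y) :
    AllegoryOps.meet (AllegoryOps.meet r s) t = AllegoryOps.meet r (AllegoryOps.meet s t)
  comp_mono {X Y Z : A} {r r' : X ⟶ Y} {s s' : Y ⟶ Z} (hr : Le r r') (hs : Le s s') :
    Le (r ≫ s) (r' ≫ s')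
  conv_conv {X Y : A} (r : X ⟶ Y) : conv (conv r) = r
  conv_id (X : A) : conv (𝟙 X) = 𝟙 X
  conv_comp {X Y Z : A} (r : X ⟶ Y) (s : Y ⟶ Z) : conv (r ≫ s) = conv s ≫ conv r
  conv_meet {X Y : A} (r s : X ⟶ Y) :
    conv (AllegoryOps.meet r s) = AllegoryOps.meet (conv r) (conv s)
  modular {X Y Z : A} (r : X ⟶ Y) (s : Y ⟶ Z) (t : X ⟶ Z) :
    Le (AllegoryOps.meet (r ≫ s) t) (AllegoryOps.meet r (t ≫ conv s) ≫ s)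

section

variable [IsAllegory A]

/-- The hom-sets of an allegory are meet-semilattices, ordered by `Le`. -/
instance homSemilatticeInf (X Y : A) : SemilatticeInf (X ⟶ Y) where
  le := Le
  inf := AllegoryOps.meet
  le_refl := IsAllegory.meet_self
  le_trans r s t (hrs : _ = _) (hst : _ = _) := by
    change _ = _
    rw [← hrs, IsAllegory.meet_assoc, hst]
  le_antisymm r s (hrs : _ = _) (hsr : _ = _) := by
    rw [← hrs, IsAllegory.meet_comm, hsr]
  inf_le_left r s := by
    change _ = _
    rw [IsAllegory.meet_comm r s, IsAllegory.meet_assoc, IsAllegory.meet_self]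
  inf_le_right r s := by
    change _ = _
    rw [IsAllegory.meet_assoc, IsAllegory.meet_self]
  le_inf r s t (hrs : _ = _) (hrt : _ = _) := by
    change _ = _
    rw [← IsAllegory.meet_assoc, hrs, hrt]

theorem comp_le_comp {X Y Z : A} {r r' : X ⟶ Y} {s s' : Y ⟶ Z} (hr : r ≤ r') (hs : s ≤ s') :
    r ≫ s ≤ r' ≫ s' :=
  IsAllegory.comp_mono hr hs

theorem conv_le_conv {X Y : A} {r s : X ⟶ Y} (h : r ≤ s) : conv r ≤ conv s := by
  change AllegoryOps.meet _ _ = _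
  rw [← IsAllegory.conv_meet]
  exact congrArg conv h

theorem modular_right {X Y Z : A} (r : X ⟶ Y) (s : Y ⟶ Z) (t : X ⟶ Z) :
    (r ≫ s) ⊓ t ≤ (r ⊓ (t ≫ conv s)) ≫ s :=
  IsAllegory.modular r s t

theorem conv_inf {X Y : A} (r s : X ⟶ Y) : conv (r ⊓ s) = conv r ⊓ conv s :=
  IsAllegory.conv_meet r s

theorem modular_left {X Y Z : A} (r : X ⟶ Y) (s : Y ⟶ Z) (t : X ⟶ Z) :
    (r ≫ s) ⊓ t ≤ r ≫ (s ⊓ (conv r ≫ t)) := by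
  have h := conv_le_conv (modular_right (conv s) (conv r) (conv t))
  simpa only [conv_inf, IsAllegory.conv_comp, IsAllegory.conv_conv] using h

/-- A morphism `r` of an allegory is a map if `1 ≤ r° · r` and `r · r° ≤ 1`. -/
structure IsMap {X Y : A} (r : X ⟶ Y) : Prop where
  le_comp_conv : 𝟙 X ≤ r ≫ conv r
  conv_comp_le : conv r ≫ r ≤ 𝟙 Y

variable (A) in
/-- The class of maps of an allegory. -/
def maps : MorphismProperty A := fun _ _ r => IsMap r

instance : (maps A).IsMultiplicative where
  id_mem X := ⟨by simp [IsAllegory.conv_id], by simp [IsAllegory.conv_id]⟩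
  comp_mem {X Y Z} r s hr hs := by
    constructor
    · calc 𝟙 X ≤ r ≫ conv r := hr.1
        _ = r ≫ 𝟙 Y ≫ conv r := by simp
        _ ≤ r ≫ (s ≫ conv s) ≫ conv r :=
          comp_le_comp le_rfl (comp_le_comp hs.1 le_rfl)
        _ = (r ≫ s) ≫ conv (r ≫ s) := by simp [IsAllegory.conv_comp]
    · calc conv (r ≫ s) ≫ r ≫ s = conv s ≫ (conv r ≫ r) ≫ s := by simp [IsAllegory.conv_comp]
        _ ≤ conv s ≫ 𝟙 Y ≫ s := comp_le_comp le_rfl (comp_le_comp hr.2 le_rfl)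
        _ = conv s ≫ s := by simp
        _ ≤ 𝟙 Z := hs.2

variable (A) in
/-- The category of maps of an allegory. -/
abbrev MapCat := WideSubcategory (maps A)

/-- The pair of maps `f : T ⟶ X`, `g : T ⟶ Y` tabulates `r : X ⟶ Y` if `r = g · f°` and
`(f° · f) ∧ (g° · g) = 1`. -/
structure Tabulates {T X Y : A} (f : T ⟶ X) (g : T ⟶ Y) (r : X ⟶ Y) : Prop where
  isMap_left : IsMap f
  isMap_right : IsMap g
  eq : r = conv f ≫ g
  inf_eq : (f ≫ conv f) ⊓ (g ≫ conv g) = 𝟙 T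

/-- An object `E` is a unit if the identity of `E` is the largest endomorphism of `E`, and each
object `X` has a morphism `r : X ⟶ E` with `1 ≤ r° · r`. -/
structure IsUnitObj (E : A) : Prop where
  le_id (r : E ⟶ E) : r ≤ 𝟙 E
  exists_le (X : A) : ∃ r : X ⟶ E, 𝟙 X ≤ r ≫ conv r

end

variable (A) in
/-- A unitary tabular allegory: an allegory in which each morphism has a tabulation, and
which has a unit. -/
class IsUTabAllegory : Prop extends IsAllegory A where
  tabular {X Y : A} (r : X ⟶ Y) : ∃ (T : A) (f : T ⟶ X) (g : T ⟶ Y), Tabulates f g r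
  unitary : ∃ E : A, IsUnitObj E

/-! ### Tabulations and pullbacks of maps -/

section

variable [IsAllegory A]

theorem IsMap.eq_of_le {X Y : A} {f g : X ⟶ Y} (hf : IsMap f) (hg : IsMap g) (h : f ≤ g) :
    f = g := by
  refine le_antisymm h ?_
  calc g = 𝟙 X ≫ g := by simp
    _ ≤ (f ≫ conv f) ≫ g := comp_le_comp hf.1 le_rfl
    _ = f ≫ conv f ≫ g := by simp
    _ ≤ f ≫ conv g ≫ g := comp_le_comp le_rfl (comp_le_comp (conv_le_conv h) le_rfl)
    _ ≤ f ≫ 𝟙 Y := comp_le_comp le_rfl hg.2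
    _ = f := by simp

theorem id_le_inf_comp {Z T : A} (a : Z ⟶ T) (b : T ⟶ Z) (h : 𝟙 Z ≤ a ≫ b) :
    𝟙 Z ≤ (a ⊓ conv b) ≫ conv (a ⊓ conv b) := by
  have h1 : 𝟙 Z ≤ (a ⊓ conv b) ≫ b := by
    calc 𝟙 Z ≤ (a ≫ b) ⊓ 𝟙 Z := le_inf h le_rfl
      _ ≤ (a ⊓ (𝟙 Z ≫ conv b)) ≫ b := modular_right _ _ _
      _ = _ := by simp
  calc 𝟙 Z ≤ ((a ⊓ conv b) ≫ b) ⊓ 𝟙 Z := le_inf h1 le_rfl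
    _ ≤ (a ⊓ conv b) ≫ (b ⊓ (conv (a ⊓ conv b) ≫ 𝟙 Z)) := modular_left _ _ _
    _ ≤ (a ⊓ conv b) ≫ conv (a ⊓ conv b) :=
      comp_le_comp le_rfl (by simp)

theorem Tabulates.exists_lift {T X Y Z : A} {x : T ⟶ X} {y : T ⟶ Y} {r : X ⟶ Y}
    (ht : Tabulates x y r) {p : Z ⟶ X} {q : Z ⟶ Y} (hp : IsMap p) (hq : IsMap q)
    (h : conv p ≫ q ≤ r) : ∃ z : Z ⟶ T, IsMap z ∧ z ≫ x = p ∧ z ≫ y = q := by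
  have hx := ht.isMap_left
  have hy := ht.isMap_right
  let z : Z ⟶ T := (p ≫ conv x) ⊓ (q ≫ conv y)
  have hz1 : z ≤ p ≫ conv x := inf_le_left
  have hz2 : z ≤ q ≫ conv y := inf_le_right
  have key : ∀ {W : A} (w : T ⟶ W) (s : Z ⟶ W), IsMap s → z ≤ s ≫ conv w →
      conv z ≫ z ≤ w ≫ conv w := by
    intro W w s hs hzs
    calc conv z ≫ z ≤ conv (s ≫ conv w) ≫ s ≫ conv w := comp_le_comp (conv_le_conv hzs) hzs
      _ = w ≫ (conv s ≫ s) ≫ conv w := by simp [IsAllegory.conv_comp, IsAllegory.conv_conv]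
      _ ≤ w ≫ 𝟙 W ≫ conv w := comp_le_comp le_rfl (comp_le_comp hs.2 le_rfl)
      _ = w ≫ conv w := by simp
  have key2 : ∀ {W : A} (w : T ⟶ W) (s : Z ⟶ W), IsMap w → z ≤ s ≫ conv w → z ≫ w ≤ s := by
    intro W w s hw hzs
    calc z ≫ w ≤ (s ≫ conv w) ≫ w := comp_le_comp hzs le_rfl
      _ = s ≫ conv w ≫ w := by simp
      _ ≤ s ≫ 𝟙 W := comp_le_comp le_rfl hw.2
      _ = s := by simp
  have hz : IsMap z := by
    constructor
    · have h1 : 𝟙 Z ≤ (p ≫ conv x) ≫ (y ≫ conv q) := by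
        calc 𝟙 Z = 𝟙 Z ≫ 𝟙 Z := by simp
          _ ≤ (p ≫ conv p) ≫ (q ≫ conv q) := comp_le_comp hp.1 hq.1
          _ = p ≫ (conv p ≫ q) ≫ conv q := by simp
          _ ≤ p ≫ (conv x ≫ y) ≫ conv q :=
            comp_le_comp le_rfl (comp_le_comp (h.trans_eq ht.eq) le_rfl)
          _ = _ := by simp
      have h2 := id_le_inf_comp _ _ h1
      simpa only [IsAllegory.conv_comp, IsAllegory.conv_conv] using h2
    · exact (le_inf (key x p hp hz1) (key y q hq hz2)).trans_eq ht.inf_eq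
  exact ⟨z, hz, ((maps A).comp_mem _ _ hz hx).eq_of_le hp (key2 x p hx hz1),
    ((maps A).comp_mem _ _ hz hy).eq_of_le hq (key2 y q hy hz2)⟩

theorem Tabulates.eq_of_comp_eq {T X Y Z : A} {x : T ⟶ X} {y : T ⟶ Y} {r : X ⟶ Y}
    (ht : Tabulates x y r) {z z' : Z ⟶ T} (hz : IsMap z) (hz' : IsMap z')
    (h₁ : z ≫ x = z' ≫ x) (h₂ : z ≫ y = z' ≫ y) : z = z' := by
  refine hz.eq_of_le hz' ?_
  have hle : conv z' ≫ z ≤ 𝟙 T := by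
    have key : ∀ {W : A} (w : T ⟶ W), IsMap w → z ≫ w = z' ≫ w → conv z' ≫ z ≤ w ≫ conv w := by
      intro W w hw e
      calc conv z' ≫ z = conv z' ≫ z ≫ 𝟙 T := by simp
        _ ≤ conv z' ≫ z ≫ w ≫ conv w := comp_le_comp le_rfl (comp_le_comp le_rfl hw.1)
        _ = (conv z' ≫ z') ≫ w ≫ conv w := by
          rw [← Category.assoc z, e]; simp
        _ ≤ 𝟙 T ≫ w ≫ conv w := comp_le_comp hz'.2 le_rfl
        _ = w ≫ conv w := by simp
    exact (le_inf (key x ht.isMap_left h₁) (key y ht.isMap_right h₂)).trans_eq ht.inf_eq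
  calc z = 𝟙 Z ≫ z := by simp
    _ ≤ (z' ≫ conv z') ≫ z := comp_le_comp hz'.1 le_rfl
    _ = z' ≫ conv z' ≫ z := by simp
    _ ≤ z' ≫ 𝟙 T := comp_le_comp le_rfl hle
    _ = z' := by simp

/-- Tabulations give pullbacks in the category of maps. -/
theorem Tabulates.isPullback {T X Y Z : MapCat A} {x : T ⟶ X} {y : T ⟶ Y} {h : X ⟶ Z} {k : Y ⟶ Z}
    (ht : Tabulates x.hom y.hom (h.hom ≫ conv k.hom)) : IsPullback x y h k := by
  have hx : IsMap x.hom := x.property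
  have hy : IsMap y.hom := y.property
  have hh : IsMap h.hom := h.property
  have hk : IsMap k.hom := k.property
  have comm : x ≫ h = y ≫ k := by
    refine WideSubcategory.hom_ext _ (Eq.symm ?_)
    refine IsMap.eq_of_le ((maps A).comp_mem _ _ hy hk) ((maps A).comp_mem _ _ hx hh) ?_
    calc y.hom ≫ k.hom = 𝟙 _ ≫ y.hom ≫ k.hom := by simp
      _ ≤ (x.hom ≫ conv x.hom) ≫ y.hom ≫ k.hom := comp_le_comp hx.1 le_rfl
      _ = x.hom ≫ (conv x.hom ≫ y.hom) ≫ k.hom := by simp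
      _ = x.hom ≫ h.hom ≫ conv k.hom ≫ k.hom := by rw [← ht.eq]; simp
      _ ≤ x.hom ≫ h.hom ≫ 𝟙 _ := comp_le_comp le_rfl (comp_le_comp le_rfl hk.2)
      _ = x.hom ≫ h.hom := by simp
  refine IsPullback.mk ⟨comm⟩ ⟨PullbackCone.isLimitAux' _ fun s => ?_⟩
  have hp : IsMap s.fst.hom := s.fst.property
  have hq : IsMap s.snd.hom := s.snd.property
  have hle : conv s.fst.hom ≫ s.snd.hom ≤ h.hom ≫ conv k.hom := by
    have hc : s.fst.hom ≫ h.hom = s.snd.hom ≫ k.hom :=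
      congrArg InducedWideCategory.Hom.hom s.condition
    calc conv s.fst.hom ≫ s.snd.hom = conv s.fst.hom ≫ s.snd.hom ≫ 𝟙 _ := by simp
      _ ≤ conv s.fst.hom ≫ s.snd.hom ≫ k.hom ≫ conv k.hom :=
        comp_le_comp le_rfl (comp_le_comp le_rfl hk.1)
      _ = (conv s.fst.hom ≫ s.fst.hom) ≫ h.hom ≫ conv k.hom := by
        rw [← Category.assoc s.snd.hom, ← hc]; simp
      _ ≤ 𝟙 _ ≫ h.hom ≫ conv k.hom := comp_le_comp hp.2 le_rfl
      _ = h.hom ≫ conv k.hom := by simp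
  have hex := ht.exists_lift hp hq hle
  refine ⟨⟨hex.choose, hex.choose_spec.1⟩, WideSubcategory.hom_ext _ hex.choose_spec.2.1,
    WideSubcategory.hom_ext _ hex.choose_spec.2.2, ?_⟩
  intro m hm₁ hm₂
  refine WideSubcategory.hom_ext _ (ht.eq_of_comp_eq m.property hex.choose_spec.1 ?_ ?_)
  · rw [hex.choose_spec.2.1]; exact congrArg InducedWideCategory.Hom.hom hm₁
  · rw [hex.choose_spec.2.2]; exact congrArg InducedWideCategory.Hom.hom hm₂

end

end Allegory

/-! ## The 2-category of unitary tabular allegories -/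

section Representation

variable {A : Type u₁} [Category.{v₁} A] [AllegoryOps A] [IsAllegory A]
  {B : Type u₂} [Category.{v₂} B] [AllegoryOps B] [IsAllegory B]

/-- Unitary representations: functors that preserve units and commute with the involutions and
the meet operations. -/
structure IsUnitaryRep (R : A ⥤ B) : Prop where
  map_conv {X Y : A} (r : X ⟶ Y) : R.map (conv r) = conv (R.map r)
  map_inf {X Y : A} (r s : X ⟶ Y) : R.map (r ⊓ s) = R.map r ⊓ R.map s
  map_unit (E : A) : IsUnitObj E → IsUnitObj (R.obj E)

variable {R S : A ⥤ B}

theorem IsUnitaryRep.map_le (hR : IsUnitaryRep R) {X Y : A} {r s : X ⟶ Y} (h : r ≤ s) :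
    R.map r ≤ R.map s := by
  rw [← inf_eq_left] at h ⊢
  rw [← hR.map_inf, h]

theorem IsUnitaryRep.map_isMap (hR : IsUnitaryRep R) {X Y : A} {r : X ⟶ Y} (h : IsMap r) :
    IsMap (R.map r) where
  le_comp_conv := by simpa [hR.map_conv] using hR.map_le h.1
  conv_comp_le := by simpa [hR.map_conv] using hR.map_le h.2

/-- The restriction of a unitary representation to the categories of maps. -/
def IsUnitaryRep.mapFunctor (hR : IsUnitaryRep R) : MapCat A ⥤ MapCat B where
  obj X := ⟨R.obj X.obj⟩
  map f := ⟨R.map f.hom, hR.map_isMap f.property⟩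
  map_id _ := WideSubcategory.hom_ext _ (R.map_id _)
  map_comp _ _ := WideSubcategory.hom_ext _ (R.map_comp _ _)

theorem IsUnitaryRep.map_tabulates (hR : IsUnitaryRep R) {T X Y : A} {f : T ⟶ X} {g : T ⟶ Y}
    {r : X ⟶ Y} (h : Tabulates f g r) : Tabulates (R.map f) (R.map g) (R.map r) where
  isMap_left := hR.map_isMap h.1
  isMap_right := hR.map_isMap h.2
  eq := by rw [h.eq, R.map_comp, hR.map_conv]
  inf_eq := by
    rw [← hR.map_conv, ← hR.map_conv, ← R.map_comp, ← R.map_comp, ← hR.map_inf, h.inf_eq, R.map_id]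

/-- The 2-cells of unitary tabular allegories: natural transformations whose components are maps
and whose naturality squares at maps are pullbacks in the category of maps of the codomain. -/
structure IsMapCell (hR : IsUnitaryRep R) (hS : IsUnitaryRep S) (φ : R ⟶ S) : Prop where
  app_isMap (X : A) : IsMap (φ.app X)
  isPullback {X Y : MapCat A} (f : X ⟶ Y) :
    IsPullback (hR.mapFunctor.map f)
      (⟨φ.app X.obj, app_isMap X.obj⟩ : hR.mapFunctor.obj X ⟶ hS.mapFunctor.obj X)
      (⟨φ.app Y.obj, app_isMap Y.obj⟩ : hR.mapFunctor.obj Y ⟶ hS.mapFunctor.obj Y)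
      (hS.mapFunctor.map f)

end Representation

theorem IsUnitaryRep.map_isPullback {A : Type u₁} [Category.{v₁} A] [AllegoryOps A]
    [IsUTabAllegory A] {B : Type u₂} [Category.{v₂} B] [AllegoryOps B] [IsAllegory B] {R : A ⥤ B}
    (hR : IsUnitaryRep R) {P X Y Z : MapCat A} {p : P ⟶ X} {q : P ⟶ Y} {h : X ⟶ Z} {k : Y ⟶ Z}
    (sq : IsPullback p q h k) :
    IsPullback (hR.mapFunctor.map p) (hR.mapFunctor.map q) (hR.mapFunctor.map h)
      (hR.mapFunctor.map k) := by
  obtain ⟨T, x, y, ht⟩ := IsUTabAllegory.tabular (h.hom ≫ conv k.hom)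
  let T' : MapCat A := ⟨T⟩
  let x' : T' ⟶ X := ⟨x, ht.1⟩
  let y' : T' ⟶ Y := ⟨y, ht.2⟩
  have sq' : IsPullback x' y' h k := Tabulates.isPullback ht
  have ht' : Tabulates (hR.mapFunctor.map x').hom (hR.mapFunctor.map y').hom
      ((hR.mapFunctor.map h).hom ≫ conv (hR.mapFunctor.map k).hom) := by
    have := hR.map_tabulates ht
    rw [R.map_comp, hR.map_conv] at this
    exact this
  have sqB := Tabulates.isPullback ht'
  let e : P ≅ T' := sq.isoIsPullback _ _ sq'
  refine sqB.of_iso (hR.mapFunctor.mapIso e.symm) (Iso.refl _) (Iso.refl _) (Iso.refl _) ?_ ?_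
    (by simp) (by simp)
  · simp [e, ← Functor.map_comp]
  · simp [e, ← Functor.map_comp]

end SpanAllegory

namespace SpanAllegory

theorem eq_id_comp_comp_id {C : Type u} [Category.{v} C] {X Y : C} (f : X ⟶ Y) :
    f = 𝟙 X ≫ f ≫ 𝟙 Y := by
  simp

set_option linter.checkUnivs false in
/-- Unitary tabular allegories, the objects of a 2-category. -/
structure UTabAll : Type (max (u + 1) (v + 1)) where
  carrier : Type u
  [category : Category.{v} carrier]
  [ops : AllegoryOps carrier]
  [isUTabAllegory : IsUTabAllegory carrier]

namespace UTabAll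

attribute [instance] category ops isUTabAllegory

/-- A 1-cell of unitary tabular allegories is a unitary representation. -/
structure Hom (A B : UTabAll.{v, u}) where
  toFunctor : A.carrier ⥤ B.carrier
  isUnitaryRep : IsUnitaryRep toFunctor

/-- The 2-cells of unitary tabular allegories. -/
@[ext]
structure Hom₂ {A B : UTabAll.{v, u}} (R S : Hom A B) where
  toNatTrans : R.toFunctor ⟶ S.toFunctor
  isMapCell : IsMapCell R.isUnitaryRep S.isUnitaryRep toNatTrans

instance (A B : UTabAll.{v, u}) : Category (Hom A B) where
  Hom := Hom₂
  id R :=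
    { toNatTrans := 𝟙 R.toFunctor
      isMapCell :=
        { app_isMap := fun X => (maps B.carrier).id_mem (R.toFunctor.obj X)
          isPullback := fun f =>
            IsPullback.of_vert_isIso (snd := 𝟙 _) (f := 𝟙 _) ⟨by simp⟩ } }
  comp φ ψ :=
    { toNatTrans := φ.toNatTrans ≫ ψ.toNatTrans
      isMapCell :=
        { app_isMap := fun X =>
            (maps B.carrier).comp_mem _ _ (φ.isMapCell.app_isMap X) (ψ.isMapCell.app_isMap X)
          isPullback := fun f =>
            (φ.isMapCell.isPullback f).paste_vert (ψ.isMapCell.isPullback f) } }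
  id_comp φ := Hom₂.ext (Category.id_comp φ.toNatTrans)
  comp_id φ := Hom₂.ext (Category.comp_id φ.toNatTrans)
  assoc φ ψ χ := Hom₂.ext (Category.assoc φ.toNatTrans ψ.toNatTrans χ.toNatTrans)

instance : CategoryStruct UTabAll.{v, u} where
  Hom := Hom
  id A :=
    { toFunctor := 𝟭 A.carrier
      isUnitaryRep :=
        { map_conv := fun _ => rfl
          map_inf := fun _ _ => rfl
          map_unit := fun _ h => h } }
  comp R S :=
    { toFunctor := R.toFunctor ⋙ S.toFunctor
      isUnitaryRep :=
        { map_conv := fun r => by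
            simp [R.isUnitaryRep.map_conv, S.isUnitaryRep.map_conv]
          map_inf := fun r s => by
            simp [R.isUnitaryRep.map_inf, S.isUnitaryRep.map_inf]
          map_unit := fun E h => S.isUnitaryRep.map_unit _ (R.isUnitaryRep.map_unit E h) } }

instance (A B : UTabAll.{v, u}) : Category (A ⟶ B) :=
  inferInstanceAs (Category (Hom A B))

@[ext]
theorem hom₂_ext {A B : UTabAll.{v, u}} {R S : A ⟶ B} {φ ψ : R ⟶ S}
    (h : ∀ X, φ.toNatTrans.app X = ψ.toNatTrans.app X) : φ = ψ :=
  Hom₂.ext (NatTrans.ext (funext h))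

/-- The 2-category of unitary tabular allegories, with horizontal and vertical composition as for
functors and natural transformations. -/
instance : Bicategory UTabAll.{v, u} where
  homCategory A B := inferInstanceAs (Category (Hom A B))
  whiskerLeft {_ _ _} R {_ _} φ :=
    { toNatTrans := R.toFunctor.whiskerLeft φ.toNatTrans
      isMapCell :=
        { app_isMap := fun X => φ.isMapCell.app_isMap (R.toFunctor.obj X)
          isPullback := fun f => φ.isMapCell.isPullback (R.isUnitaryRep.mapFunctor.map f) } }
  whiskerRight {_ _ _} {_ _} φ S :=
    { toNatTrans := Functor.whiskerRight φ.toNatTrans S.toFunctor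
      isMapCell :=
        { app_isMap := fun X => S.isUnitaryRep.map_isMap (φ.isMapCell.app_isMap X)
          isPullback := fun f => S.isUnitaryRep.map_isPullback (φ.isMapCell.isPullback f) } }
  associator R S T := Iso.refl (R ≫ S ≫ T)
  leftUnitor R := Iso.refl R
  rightUnitor R := Iso.refl R
  whiskerLeft_id R S := by ext X; exact rfl
  whiskerLeft_comp R _ _ _ φ ψ := by ext X; exact rfl
  id_whiskerLeft φ := by ext X; exact eq_id_comp_comp_id (φ.toNatTrans.app X)
  comp_whiskerLeft R S _ _ φ := by ext X; exact eq_id_comp_comp_id (φ.toNatTrans.app _)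
  id_whiskerRight R S := by ext X; exact S.toFunctor.map_id _
  comp_whiskerRight φ ψ S := by ext X; exact S.toFunctor.map_comp _ _
  whiskerRight_id φ := by ext X; exact eq_id_comp_comp_id (φ.toNatTrans.app X)
  whiskerRight_comp φ S T := by
    ext X; exact eq_id_comp_comp_id (T.toFunctor.map (S.toFunctor.map (φ.toNatTrans.app X)))
  whisker_assoc R _ _ φ T := by
    ext X; exact eq_id_comp_comp_id (T.toFunctor.map (φ.toNatTrans.app (R.toFunctor.obj X)))
  whisker_exchange φ ψ := by
    ext X; exact (ψ.toNatTrans.naturality (φ.toNatTrans.app X)).symm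
  pentagon R S T U := by
    ext X
    exact (congrArg (· ≫ (𝟙 _ ≫ 𝟙 _)) (U.toFunctor.map_id _)).trans
      (Category.id_comp _)
  triangle R S := by
    ext X
    exact (Category.id_comp _).trans (S.toFunctor.map_id _).symm

instance : Bicategory.Strict UTabAll.{v, u} where
  id_comp _ := rfl
  comp_id _ := rfl
  assoc _ _ _ := rfl
  leftUnitor_eqToIso _ := rfl
  rightUnitor_eqToIso _ := rfl
  associator_eqToIso _ _ _ := rfl

end UTabAll

end SpanAllegory

/-! ## Finitely complete categories with a stable factorization system -/

namespace SpanAllegory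

section Classes

variable {C : Type u} [Category.{v} C]

/-- A stable system: a class of morphisms that contains the isomorphisms, is closed under
composition, and is stable under pullback. -/
class IsStableSystem (W : MorphismProperty C) : Prop where
  of_isIso {X Y : C} (f : X ⟶ Y) : IsIso f → W f
  comp_mem {X Y Z : C} (f : X ⟶ Y) (g : Y ⟶ Z) : W f → W g → W (f ≫ g)
  of_isPullback {P X Y Z : C} {fst : P ⟶ X} {snd : P ⟶ Y} {f : X ⟶ Z} {g : Y ⟶ Z} :
    IsPullback fst snd f g → W g → W fst

/-- The least stable system containing a class of morphisms. -/
def leastStableSystem (W : MorphismProperty C) : MorphismProperty C := fun _ _ f =>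
  ∀ S : MorphismProperty C, IsStableSystem S → W ≤ S → S f

instance (W : MorphismProperty C) : IsStableSystem (leastStableSystem W) where
  of_isIso f hf _ hS _ := hS.of_isIso f hf
  comp_mem f g hf hg S hS h := hS.comp_mem f g (hf S hS h) (hg S hS h)
  of_isPullback sq hg _ hS h := hS.of_isPullback sq (hg _ hS h)

theorem le_leastStableSystem (W : MorphismProperty C) : W ≤ leastStableSystem W :=
  fun _ _ f hf _ _ h => h f hf

/-- An (orthogonal) factorization system `(E, M)`, where the class `E` is stable under pullback. -/
structure IsStableFactorizationSystem (E M : MorphismProperty C) : Prop where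
  respectsIso_left : E.RespectsIso
  respectsIso_right : M.RespectsIso
  exists_factorization {X Y : C} (f : X ⟶ Y) :
    ∃ (Z : C) (e : X ⟶ Z) (m : Z ⟶ Y), E e ∧ M m ∧ e ≫ m = f
  existsUnique_diagonal {A B X Y : C} (e : A ⟶ B) (m : X ⟶ Y) (f : A ⟶ X) (g : B ⟶ Y) :
    E e → M m → e ≫ g = f ≫ m → ∃! d : B ⟶ X, e ≫ d = f ∧ d ≫ m = g
  isStableUnderBaseChange : E.IsStableUnderBaseChange

/-- The morphisms `c : P ⟶ Q` which are the conjugate of some `m ∈ M` along some `f` and `s`: here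
`P` is a pullback of `s` along `f`, `Q` is a pullback of `s ≫ m` along `f ≫ m`, and `c` is the
comparison morphism. -/
def conjugates (M : MorphismProperty C) : MorphismProperty C := fun P Q c =>
  ∃ (A S X Y : C) (m : X ⟶ Y) (f : A ⟶ X) (s : S ⟶ X) (f' : P ⟶ S) (s' : P ⟶ A)
    (g' : Q ⟶ S) (t' : Q ⟶ A),
    M m ∧ IsPullback f' s' s f ∧ IsPullback g' t' (s ≫ m) (f ≫ m) ∧ c ≫ g' = f' ∧ c ≫ t' = s'

/-- The closure under pullback of the class of all conjugates of morphisms in `M`. -/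
def starClass (M : MorphismProperty C) : MorphismProperty C := (conjugates M).pullbacks

/-- The least stable system containing `E` and `starClass M`. -/
def bulletClass (E M : MorphismProperty C) : MorphismProperty C :=
  leastStableSystem (E ⊔ starClass M)

end Classes

set_option linter.checkUnivs false in
/-- Finitely complete categories with a stable factorization system, the objects of a 2-category. -/
structure StabFact : Type (max (u + 1) (v + 1)) where
  carrier : Type u
  [category : Category.{v} carrier]
  [hasFiniteLimits : HasFiniteLimits carrier]
  E : MorphismProperty carrier
  M : MorphismProperty carrier
  isStableFactorizationSystem : IsStableFactorizationSystem E M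

namespace StabFact

attribute [instance] category hasFiniteLimits

/-- The 1-cells are the functors that preserve finite limits and the two classes of morphisms. -/
structure Hom (C D : StabFact.{v, u}) where
  toFunctor : C.carrier ⥤ D.carrier
  [preservesFiniteLimits : PreservesFiniteLimits toFunctor]
  map_E {X Y : C.carrier} (f : X ⟶ Y) : C.E f → D.E (toFunctor.map f)
  map_M {X Y : C.carrier} (f : X ⟶ Y) : C.M f → D.M (toFunctor.map f)

attribute [instance] Hom.preservesFiniteLimits

/-- The 2-cells are the natural transformations all of whose naturality squares are pullbacks. -/
@[ext]
structure Hom₂ {C D : StabFact.{v, u}} (F G : Hom C D) where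
  toNatTrans : F.toFunctor ⟶ G.toFunctor
  isPullback {X Y : C.carrier} (f : X ⟶ Y) :
    IsPullback (F.toFunctor.map f) (toNatTrans.app X) (toNatTrans.app Y) (G.toFunctor.map f)

instance (C D : StabFact.{v, u}) : Category (Hom C D) where
  Hom := Hom₂
  id F :=
    { toNatTrans := 𝟙 F.toFunctor
      isPullback := fun f => IsPullback.of_vert_isIso (snd := 𝟙 _) (f := 𝟙 _) ⟨by simp⟩ }
  comp θ η :=
    { toNatTrans := θ.toNatTrans ≫ η.toNatTrans
      isPullback := fun f => (θ.isPullback f).paste_vert (η.isPullback f) }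
  id_comp θ := Hom₂.ext (Category.id_comp θ.toNatTrans)
  comp_id θ := Hom₂.ext (Category.comp_id θ.toNatTrans)
  assoc θ η κ := Hom₂.ext (Category.assoc θ.toNatTrans η.toNatTrans κ.toNatTrans)

instance : CategoryStruct StabFact.{v, u} where
  Hom := Hom
  id C :=
    { toFunctor := 𝟭 C.carrier
      map_E := fun _ h => h
      map_M := fun _ h => h }
  comp F G :=
    { toFunctor := F.toFunctor ⋙ G.toFunctor
      preservesFiniteLimits := comp_preservesFiniteLimits F.toFunctor G.toFunctor
      map_E := fun f h => G.map_E _ (F.map_E f h)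
      map_M := fun f h => G.map_M _ (F.map_M f h) }

instance (C D : StabFact.{v, u}) : Category (C ⟶ D) :=
  inferInstanceAs (Category (Hom C D))

@[ext]
theorem hom₂_ext {C D : StabFact.{v, u}} {F G : C ⟶ D} {θ η : F ⟶ G}
    (h : ∀ X, θ.toNatTrans.app X = η.toNatTrans.app X) : θ = η :=
  Hom₂.ext (NatTrans.ext (funext h))

/-- The 2-category of finitely complete categories with a stable factorization system, with
horizontal and vertical composition as for functors and natural transformations. -/
instance : Bicategory StabFact.{v, u} where
  homCategory C D := inferInstanceAs (Category (Hom C D))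
  whiskerLeft {_ _ _} F {_ _} θ :=
    { toNatTrans := F.toFunctor.whiskerLeft θ.toNatTrans
      isPullback := fun f => θ.isPullback (F.toFunctor.map f) }
  whiskerRight {_ _ _} {_ _} θ G :=
    { toNatTrans := Functor.whiskerRight θ.toNatTrans G.toFunctor
      isPullback := fun f => (θ.isPullback f).map G.toFunctor }
  associator F G H := Iso.refl (F ≫ G ≫ H)
  leftUnitor F := Iso.refl F
  rightUnitor F := Iso.refl F
  whiskerLeft_id F G := by ext X; exact rfl
  whiskerLeft_comp F _ _ _ θ η := by ext X; exact rfl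
  id_whiskerLeft θ := by ext X; exact eq_id_comp_comp_id (θ.toNatTrans.app X)
  comp_whiskerLeft F G _ _ θ := by ext X; exact eq_id_comp_comp_id (θ.toNatTrans.app _)
  id_whiskerRight F G := by ext X; exact G.toFunctor.map_id _
  comp_whiskerRight θ η G := by ext X; exact G.toFunctor.map_comp _ _
  whiskerRight_id θ := by ext X; exact eq_id_comp_comp_id (θ.toNatTrans.app X)
  whiskerRight_comp θ G H := by
    ext X; exact eq_id_comp_comp_id (H.toFunctor.map (G.toFunctor.map (θ.toNatTrans.app X)))
  whisker_assoc F _ _ θ H := by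
    ext X; exact eq_id_comp_comp_id (H.toFunctor.map (θ.toNatTrans.app (F.toFunctor.obj X)))
  whisker_exchange θ η := by
    ext X; exact (η.toNatTrans.naturality (θ.toNatTrans.app X)).symm
  pentagon F G H K := by
    ext X
    exact (congrArg (· ≫ (𝟙 _ ≫ 𝟙 _)) (K.toFunctor.map_id _)).trans (Category.id_comp _)
  triangle F G := by
    ext X
    exact (Category.id_comp _).trans (G.toFunctor.map_id _).symm

instance : Bicategory.Strict StabFact.{v, u} where
  id_comp _ := rfl
  comp_id _ := rfl
  assoc _ _ _ := rfl
  leftUnitor_eqToIso _ := rfl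
  rightUnitor_eqToIso _ := rfl
  associator_eqToIso _ _ _ := rfl

end StabFact

end SpanAllegory

/-! ## Quotients of the category of spans -/

namespace SpanAllegory

section Spans

variable {C : Type u} [Category.{v} C]

/-- Spans `A ⟵ D ⟶ B`. -/
abbrev Sp (A B : C) := Span (⊤ : MorphismProperty C) ⊤ A B

/-- The span `(f, g)`. -/
abbrev sp {D A B : C} (f : D ⟶ A) (g : D ⟶ B) : Sp A B where
  apex := D
  l := f
  r := g
  wl := trivial
  wr := trivial

/-- The relation `S ≤ T`: there is a morphism of spans `S ⟶ T` that lies in `W`. -/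
def SpanLE (W : MorphismProperty C) {A B : C} (S T : Sp A B) : Prop :=
  ∃ x : S ⟶ T, W x.hom

/-- The objects of the quotient of the category of spans by `W` are the objects of `C`. -/
structure SpanQ (_W : MorphismProperty C) : Type u where
  obj : C

/-- The morphisms `A ⟶ B` are the classes `[f, g]` of spans for the least equivalence relation that
contains `SpanLE W`. -/
def SpanQ.Hom (W : MorphismProperty C) (A B : C) :=
  Quotient (Relation.EqvGen.setoid (SpanLE W (A := A) (B := B)))

/-- The class of a span. -/
def SpanQ.cls (W : MorphismProperty C) {A B : C} (S : Sp A B) : SpanQ.Hom W A B :=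
  Quotient.mk _ S

namespace SpanQ

variable {W : MorphismProperty C}

theorem cls_eq {A B : C} {S T : Sp A B} (x : S.apex ⟶ T.apex) (hx : W x) (hl : x ≫ T.l = S.l)
    (hr : x ≫ T.r = S.r) : cls W S = cls W T :=
  Quotient.sound (Relation.EqvGen.rel _ _ ⟨⟨x, hl, hr⟩, hx⟩)

theorem ind {A B : C} {p : Hom W A B → Prop} (h : ∀ S, p (cls W S)) (q : Hom W A B) : p q :=
  Quotient.ind h q

/-- A function on spans that is invariant under `SpanLE W` is defined on classes. -/
def lift {A B : C} {α : Sort*} (φ : Sp A B → α)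
    (h : ∀ S T, SpanLE W S T → φ S = φ T) : Hom W A B → α :=
  Quotient.lift φ fun S T hST => by
    induction hST with
    | rel _ _ h' => exact h _ _ h'
    | refl _ => rfl
    | symm _ _ _ ih => exact ih.symm
    | trans _ _ _ _ _ ih₁ ih₂ => exact ih₁.trans ih₂

theorem cls_eq_of_isIso [IsStableSystem W] {A B : C} {S T : Sp A B} (x : S.apex ⟶ T.apex)
    (hx : IsIso x) (hl : x ≫ T.l = S.l) (hr : x ≫ T.r = S.r) : cls W S = cls W T :=
  cls_eq x (IsStableSystem.of_isIso x hx) hl hr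

variable [HasPullbacks C]

theorem exists_pullback_map_left [IsStableSystem W] {X X' Y Z : C} (x : X ⟶ X') (hx : W x)
    (g : X' ⟶ Z) (g₀ : X ⟶ Z) (hg : x ≫ g = g₀) (h : Y ⟶ Z) :
    ∃ y : pullback g₀ h ⟶ pullback g h, W y ∧ y ≫ pullback.fst g h = pullback.fst g₀ h ≫ x ∧
      y ≫ pullback.snd g h = pullback.snd g₀ h := by
  subst hg
  let y : pullback (x ≫ g) h ⟶ pullback g h :=
    pullback.lift (pullback.fst _ _ ≫ x) (pullback.snd _ _) (by simp [pullback.condition])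
  have hy₁ : y ≫ pullback.fst g h = pullback.fst (x ≫ g) h ≫ x := pullback.lift_fst _ _ _
  have hy₂ : y ≫ pullback.snd g h = pullback.snd (x ≫ g) h := pullback.lift_snd _ _ _
  refine ⟨y, ?_, hy₁, hy₂⟩
  have sq : IsPullback y (pullback.fst (x ≫ g) h) (pullback.fst g h) x := by
    refine IsPullback.of_right ?_ hy₁ (IsPullback.of_hasPullback g h).flip
    rw [hy₂]
    exact (IsPullback.of_hasPullback (x ≫ g) h).flip
  exact IsStableSystem.of_isPullback sq hx

theorem exists_pullback_map_right [IsStableSystem W] {X Y Y' Z : C} (y : Y ⟶ Y') (hy : W y)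
    (h : Y' ⟶ Z) (h₀ : Y ⟶ Z) (hh : y ≫ h = h₀) (g : X ⟶ Z) :
    ∃ x : pullback g h₀ ⟶ pullback g h, W x ∧ x ≫ pullback.fst g h = pullback.fst g h₀ ∧
      x ≫ pullback.snd g h = pullback.snd g h₀ ≫ y := by
  subst hh
  let x : pullback g (y ≫ h) ⟶ pullback g h :=
    pullback.lift (pullback.fst _ _) (pullback.snd _ _ ≫ y) (by simp [pullback.condition])
  have hx₁ : x ≫ pullback.fst g h = pullback.fst g (y ≫ h) := pullback.lift_fst _ _ _
  have hx₂ : x ≫ pullback.snd g h = pullback.snd g (y ≫ h) ≫ y := pullback.lift_snd _ _ _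
  refine ⟨x, ?_, hx₁, hx₂⟩
  have sq : IsPullback x (pullback.snd g (y ≫ h)) (pullback.snd g h) y := by
    refine IsPullback.of_right ?_ hx₂ (IsPullback.of_hasPullback g h)
    rw [hx₁]
    exact IsPullback.of_hasPullback g (y ≫ h)
  exact IsStableSystem.of_isPullback sq hy

variable [IsStableSystem W]

/-- Composites of spans may be computed with any pullback. -/
theorem cls_comp {A B D : C} (S : Sp A B) (T : Sp B D) {P : C} {p : P ⟶ S.apex} {q : P ⟶ T.apex}
    (sq : IsPullback p q S.r T.l) :
    cls W (S.comp T) = cls W (sp (p ≫ S.l) (q ≫ T.r)) := by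
  let e := (IsPullback.of_hasPullback S.r T.l).isoIsPullback _ _ sq
  refine cls_eq_of_isIso e.hom e.isIso_hom ?_ ?_
  · exact IsPullback.isoIsPullback_hom_fst_assoc _ _ _ sq _
  · exact IsPullback.isoIsPullback_hom_snd_assoc _ _ _ sq _

theorem cls_comp_congr_left {A B D : C} {S S' : Sp A B} (h : SpanLE W S S') (T : Sp B D) :
    cls W (S.comp T) = cls W (S'.comp T) := by
  obtain ⟨x, hx⟩ := h
  obtain ⟨y, hy, h₁, h₂⟩ := exists_pullback_map_left x.hom hx S'.r S.r x.hom_r T.l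
  refine cls_eq y hy ?_ ?_
  · change y ≫ pullback.fst _ _ ≫ S'.l = pullback.fst _ _ ≫ S.l
    rw [reassoc_of% h₁, x.hom_l]
  · change y ≫ pullback.snd _ _ ≫ T.r = pullback.snd _ _ ≫ T.r
    rw [reassoc_of% h₂]

theorem cls_comp_congr_right {A B D : C} (S : Sp A B) {T T' : Sp B D} (h : SpanLE W T T') :
    cls W (S.comp T) = cls W (S.comp T') := by
  obtain ⟨x, hx⟩ := h
  obtain ⟨y, hy, h₁, h₂⟩ := exists_pullback_map_right x.hom hx T'.l T.l x.hom_l S.r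
  refine cls_eq y hy ?_ ?_
  · change y ≫ pullback.fst _ _ ≫ S.l = pullback.fst _ _ ≫ S.l
    rw [reassoc_of% h₁]
  · change y ≫ pullback.snd _ _ ≫ T'.r = pullback.snd _ _ ≫ T.r
    rw [reassoc_of% h₂, x.hom_r]

/-- The class of the identity span. -/
def idHom (W : MorphismProperty C) (A : C) : Hom W A A := cls W (Span.id A)

/-- The horizontal composition of classes of spans. -/
noncomputable def comp {A B D : C} (r : Hom W A B) (s : Hom W B D) : Hom W A D :=
  lift (fun S => lift (fun T => cls W (S.comp T)) fun _ _ h => cls_comp_congr_right S h)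
    (fun S S' h => by
      funext s
      induction s using ind with
      | h T => exact cls_comp_congr_left h T) r s

theorem idHom_comp {A B : C} (r : Hom W A B) : comp (idHom W A) r = r := by
  induction r using ind with
  | h S =>
    have sq : IsPullback S.l (𝟙 S.apex) (𝟙 A) S.l := IsPullback.of_vert_isIso ⟨by simp⟩
    refine (cls_comp (Span.id A) S sq).trans ?_
    exact cls_eq_of_isIso (𝟙 _) inferInstance
      ((Category.id_comp _).trans (Category.comp_id S.l).symm) (by simp)

theorem comp_idHom {A B : C} (r : Hom W A B) : comp r (idHom W B) = r := by
  induction r using ind with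
  | h S =>
    have sq : IsPullback (𝟙 S.apex) S.r S.r (𝟙 B) := IsPullback.of_horiz_isIso ⟨by simp⟩
    refine (cls_comp S (Span.id B) sq).trans ?_
    exact cls_eq_of_isIso (𝟙 _) inferInstance (by simp)
      ((Category.id_comp _).trans (Category.comp_id S.r).symm)

theorem comp_assoc {A B D E : C} (r : Hom W A B) (s : Hom W B D) (t : Hom W D E) :
    comp (comp r s) t = comp r (comp s t) := by
  induction r using ind with
  | h R =>
  induction s using ind with
  | h S =>
  induction t using ind with
  | h T =>
    have h₁ := IsPullback.of_hasPullback R.r S.l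
    have h₂ := IsPullback.of_hasPullback S.r T.l
    have h₃ := IsPullback.of_hasPullback (pullback.snd R.r S.l) (pullback.fst S.r T.l)
    refine (cls_comp (R.comp S) T (h₃.flip.paste_horiz h₂.flip).flip).trans ?_
    refine Eq.trans ?_ (cls_comp R (S.comp T) (h₃.flip.paste_vert h₁.flip).flip).symm
    refine cls_eq_of_isIso (𝟙 _) inferInstance ?_ ?_
    · exact (Category.id_comp _).trans (Category.assoc _ _ _)
    · exact (Category.id_comp _).trans (Category.assoc _ _ _).symm

/-- The quotient of the category of spans by the equivalence relation generated by `SpanLE W`. -/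
noncomputable instance : Category.{max u v} (SpanQ W) where
  Hom A B := Hom W A.obj B.obj
  id A := idHom W A.obj
  comp r s := comp r s
  id_comp r := idHom_comp r
  comp_id r := comp_idHom r
  assoc r s t := comp_assoc r s t

/-- The class `[f, g]` of the span `A ⟵ D ⟶ B` with legs `f` and `g`. -/
def bracket (W : MorphismProperty C) [IsStableSystem W] {D A B : C} (f : D ⟶ A) (g : D ⟶ B) :
    (⟨A⟩ : SpanQ W) ⟶ ⟨B⟩ :=
  cls W (sp f g)

theorem bracket_comp_bracket {A B D X Y P : C} (f : X ⟶ A) (g : X ⟶ B) (h : Y ⟶ B) (k : Y ⟶ D)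
    {p : P ⟶ X} {q : P ⟶ Y} (sq : IsPullback p q g h) :
    bracket W f g ≫ bracket W h k = bracket W (p ≫ f) (q ≫ k) :=
  cls_comp (sp f g) (sp h k) sq

/-- The involution `[f, g]° = [g, f]`. -/
def convHom {A B : C} : Hom W A B → Hom W B A :=
  lift (fun S => cls W (sp S.r S.l)) fun _ _ ⟨x, hx⟩ => cls_eq x.hom hx x.hom_r x.hom_l

variable [HasBinaryProducts C]

/-- The meet of two spans: their product as objects over `A × B`, given by a pullback. -/
noncomputable def spanMeet {A B : C} (S T : Sp A B) : Sp A B :=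
  sp (pullback.fst (prod.lift S.l S.r) (prod.lift T.l T.r) ≫ S.l)
    (pullback.fst (prod.lift S.l S.r) (prod.lift T.l T.r) ≫ S.r)

/-- The meet of two classes of spans, computed with representatives. -/
noncomputable def meetHom {A B : C} (r s : Hom W A B) : Hom W A B :=
  lift (fun S => lift (fun T => cls W (spanMeet S T)) fun T T' ⟨x, hx⟩ => by
      obtain ⟨y, hy, h₁, h₂⟩ := exists_pullback_map_right x.hom hx (prod.lift T'.l T'.r)
        (prod.lift T.l T.r) (by simp) (prod.lift S.l S.r)
      refine cls_eq y hy ?_ ?_ <;> simp [spanMeet, reassoc_of% h₁])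
    (fun S S' ⟨x, hx⟩ => by
      funext s
      induction s using ind with
      | h T =>
        obtain ⟨y, hy, h₁, h₂⟩ := exists_pullback_map_left x.hom hx (prod.lift S'.l S'.r)
          (prod.lift S.l S.r) (by simp) (prod.lift T.l T.r)
        refine cls_eq y hy ?_ ?_ <;> simp [spanMeet, reassoc_of% h₁]) r s

noncomputable instance : AllegoryOps (SpanQ W) where
  conv r := convHom r
  meet r s := meetHom r s

end SpanQ

end Spans

end SpanAllegory

/-! ## The induced allegories, functors and natural transformations -/

namespace SpanAllegory

section Induced

variable {C : Type u₁} [Category.{v₁} C] [HasPullbacks C] {D : Type u₂} [Category.{v₂} D]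
  [HasPullbacks D] {W : MorphismProperty C} [IsStableSystem W] {V : MorphismProperty D}
  [IsStableSystem V]

/-- The functor `[f, g] ↦ [F f, F g]` induced by a functor `F` that preserves finite limits and
sends morphisms in `W` to morphisms in `V`. -/
noncomputable def spanFunctor (F : C ⥤ D) [PreservesFiniteLimits F]
    (h : ∀ ⦃X Y : C⦄ (f : X ⟶ Y), W f → V (F.map f)) : SpanQ W ⥤ SpanQ V where
  obj A := ⟨F.obj A.obj⟩
  map {A B} r := SpanQ.lift (fun S => SpanQ.cls V (sp (F.map S.l) (F.map S.r)))
    (fun _ _ ⟨x, hx⟩ => SpanQ.cls_eq (F.map x.hom) (h _ hx)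
      ((F.map_comp _ _).symm.trans (congrArg F.map x.hom_l))
      ((F.map_comp _ _).symm.trans (congrArg F.map x.hom_r))) r
  map_id A := SpanQ.cls_eq_of_isIso (𝟙 _) (IsIso.id _)
    ((Category.id_comp _).trans (F.map_id A.obj).symm)
    ((Category.id_comp _).trans (F.map_id A.obj).symm)
  map_comp r s := by
    induction r using SpanQ.ind with
    | h S =>
    induction s using SpanQ.ind with
    | h T =>
      have sq := (IsPullback.of_hasPullback S.r T.l).map F
      refine Eq.trans ?_ (SpanQ.cls_comp (sp (F.map S.l) (F.map S.r))
        (sp (F.map T.l) (F.map T.r)) sq).symm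
      exact SpanQ.cls_eq_of_isIso (𝟙 _) (IsIso.id _)
        ((Category.id_comp _).trans (F.map_comp _ _).symm)
        ((Category.id_comp _).trans (F.map_comp _ _).symm)

theorem spanFunctor_map_bracket (F : C ⥤ D) [PreservesFiniteLimits F]
    (h : ∀ ⦃X Y : C⦄ (f : X ⟶ Y), W f → V (F.map f)) {X A B : C} (f : X ⟶ A) (g : X ⟶ B) :
    (spanFunctor F h).map (SpanQ.bracket W f g) = SpanQ.bracket V (F.map f) (F.map g) :=
  rfl

/-- The natural transformation with components `[1, θ_A]` induced by a natural transformation `θ`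
whose naturality squares are pullbacks. -/
noncomputable def spanNatTrans {F G : C ⥤ D} [PreservesFiniteLimits F] [PreservesFiniteLimits G]
    (hF : ∀ ⦃X Y : C⦄ (f : X ⟶ Y), W f → V (F.map f))
    (hG : ∀ ⦃X Y : C⦄ (f : X ⟶ Y), W f → V (G.map f)) (θ : F ⟶ G)
    (hθ : ∀ ⦃X Y : C⦄ (f : X ⟶ Y),
      IsPullback (F.map f) (θ.app X) (θ.app Y) (G.map f)) :
    spanFunctor (W := W) (V := V) F hF ⟶ spanFunctor G hG where
  app A := SpanQ.bracket V (𝟙 (F.obj A.obj)) (θ.app A.obj)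
  naturality A B r := by
    induction r using SpanQ.ind with
    | h S =>
      have sq : IsPullback (𝟙 (F.obj S.apex)) (F.map S.r) (F.map S.r) (𝟙 (F.obj B.obj)) :=
        IsPullback.of_horiz_isIso ⟨by simp⟩
      refine (SpanQ.bracket_comp_bracket (W := V) (F.map S.l) (F.map S.r) (𝟙 (F.obj B.obj))
        (θ.app B.obj) sq).trans (Eq.trans ?_ (SpanQ.bracket_comp_bracket (W := V)
          (𝟙 (F.obj A.obj)) (θ.app A.obj) (G.map S.l) (G.map S.r) (hθ S.l)).symm)
      rw [Category.id_comp, Category.comp_id, θ.naturality]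

end Induced

namespace StabFact

/-- The class `E_•` of a finitely complete category with a stable factorization system
`(E, M)`. -/
abbrev bullet (X : StabFact.{v, u}) : MorphismProperty X.carrier := bulletClass X.E X.M

instance (X : StabFact.{v, u}) : IsStableSystem X.bullet :=
  inferInstanceAs (IsStableSystem (leastStableSystem _))

theorem Hom.map_bullet {X Y : StabFact.{v, u}} (F : Hom X Y) ⦃A B : X.carrier⦄ (f : A ⟶ B)
    (hf : X.bullet f) : Y.bullet (F.toFunctor.map f) := by
  refine hf (Y.bullet.inverseImage F.toFunctor) ?_ ?_
  · exact
      { of_isIso := fun f hf => IsStableSystem.of_isIso (F.toFunctor.map f) inferInstance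
        comp_mem := fun f g hf hg => by
          change Y.bullet (F.toFunctor.map (f ≫ g))
          rw [F.toFunctor.map_comp]
          exact IsStableSystem.comp_mem _ _ hf hg
        of_isPullback := fun sq hg =>
          IsStableSystem.of_isPullback (W := Y.bullet) (sq.map F.toFunctor) hg }
  · rintro A B f (hf | hf)
    · exact le_leastStableSystem _ _ (Or.inl (F.map_E f hf))
    · refine le_leastStableSystem _ _ (Or.inr ?_)
      obtain ⟨P, Q, c, a, b, hc, sq⟩ := hf
      obtain ⟨A', S, X', Y', m, f, s, f', s', g', t', hm, sq₁, sq₂, h₁, h₂⟩ := hc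
      refine ⟨_, _, F.toFunctor.map c, F.toFunctor.map a, F.toFunctor.map b, ?_, sq.map _⟩
      refine ⟨_, _, _, _, F.toFunctor.map m, F.toFunctor.map f, F.toFunctor.map s,
        F.toFunctor.map f', F.toFunctor.map s', F.toFunctor.map g', F.toFunctor.map t',
        F.map_M m hm, sq₁.map _, ?_, ?_, ?_⟩
      · simpa only [Functor.map_comp] using sq₂.map F.toFunctor
      · rw [← Functor.map_comp, h₁]
      · rw [← Functor.map_comp, h₂]

/-- The category of spans modulo the equivalence relation given by `E_•`. -/
abbrev spanCat (X : StabFact.{v, u}) : Type u := SpanQ X.bullet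

/-- The functor on the quotients of the span categories induced by a 1-cell. -/
noncomputable abbrev Hom.span {X Y : StabFact.{v, u}} (F : Hom X Y) : X.spanCat ⥤ Y.spanCat :=
  spanFunctor F.toFunctor F.map_bullet

/-- The natural transformation induced by a 2-cell. -/
noncomputable abbrev Hom₂.span {X Y : StabFact.{v, u}} {F G : Hom X Y} (θ : Hom₂ F G) :
    F.span ⟶ G.span :=
  spanNatTrans F.map_bullet G.map_bullet θ.toNatTrans fun _ _ f => θ.isPullback f

end StabFact

end SpanAllegory

open SpanAllegory

/-! The key is that the class `W` = `E_•` admits thin images: every morphism factors as a member of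
`W` followed by a morphism whose diagonal is in `W`. For an `(E, M)`-factorization this holds
because the diagonal of `m ∈ M` is the conjugate of `m` along two identities
(`hasThinImages_bulletClass`). Applied to `⟨f, g⟩`, this replaces any span by an equivalent thin
one, whose pairing into the product has its diagonal in `W`.

Thinness of `T` makes every span morphism `x : S ⟶ T` yield `[S] ≤ [T]`: the projection of `S ∧ T`
onto `S` has the section `(1, x)`, which is a pullback of the diagonal of `T`, so `[S] = [S ∧ T]`
(`le_bracket`). Hence inequalities may be proved by arbitrary span morphisms and equalities by span
morphisms in both directions (`bracket_eq_of_homs`); the allegory laws become diagram chases with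
pullbacks. A thin span is tabulated by the graphs of its legs (`tabulates_bracket`), and a terminal
object is a unit.

A functor preserving finite limits and the two classes preserves `E_•`, composites and meets of
spans. It preserves units because the two unit conditions can be tested with the product `E × E` and
the terminal object. For 2-cells, a pullback square in the base category gives a pullback of graphs
in the category of maps (`tabulates_of_isPullback`). An arbitrary map is the inverse of an
invertible graph followed by a graph, so the naturality squares at graphs suffice
(`isPullback_of_tabulates`). -/

namespace SpanAllegory

attribute [local simp] pullback.lift_fst pullback.lift_snd pullback.lift_fst_assoc
  pullback.lift_snd_assoc prod.lift_fst prod.lift_snd prod.lift_fst_assoc prod.lift_snd_assoc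

/-! ### Thin images and diagonals -/

section ThinImages

variable {C : Type u} [Category.{v} C] [HasPullbacks C]

/-- Each morphism factors as a morphism in `W` followed by a morphism whose diagonal is in `W`. -/
class HasThinImages (W : MorphismProperty C) : Prop where
  exists_factorization {X Y : C} (f : X ⟶ Y) :
    ∃ (Z : C) (e : X ⟶ Z) (m : Z ⟶ Y), W e ∧ W (pullback.diagonal m) ∧ e ≫ m = f

/-- Take both `f` and `s` to be identities: the first pullback is `X`, the second is the kernel pair
of `m`, and the comparison between them is the diagonal. -/
theorem conjugates_diagonal {M : MorphismProperty C} {X Y : C} (m : X ⟶ Y) (hm : M m) :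
    conjugates M (pullback.diagonal m) := by
  refine ⟨X, X, X, Y, m, 𝟙 X, 𝟙 X, 𝟙 X, 𝟙 X, pullback.fst m m, pullback.snd m m, hm,
    IsPullback.of_horiz_isIso ⟨rfl⟩, ?_, by simp, by simp⟩
  simpa using IsPullback.of_hasPullback m m

theorem hasThinImages_bulletClass {E M : MorphismProperty C}
    (h : IsStableFactorizationSystem E M) : HasThinImages (bulletClass E M) where
  exists_factorization f := by
    obtain ⟨Z, e, m, he, hm, fac⟩ := h.exists_factorization f
    refine ⟨Z, e, m, le_leastStableSystem _ _ (Or.inl he), le_leastStableSystem _ _ (Or.inr ?_),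
      fac⟩
    exact MorphismProperty.le_pullbacks _ _ (conjugates_diagonal m hm)

/-- A section into a pullback is in `W` if the diagonal of the second leg is. -/
theorem lift_id_mem {W : MorphismProperty C} [IsStableSystem W] {S T B : C} (x : S ⟶ T)
    (a : S ⟶ B) (b : T ⟶ B) (h : x ≫ b = a) (hb : W (pullback.diagonal b)) :
    W (pullback.lift (𝟙 S) x (by simp [h]) : S ⟶ pullback a b) := by
  -- The section is the pullback along `z` of the diagonal of `b`, where `z` applies `x` in the
  -- first coordinate.
  let z : pullback a b ⟶ pullback b b :=
    pullback.lift (pullback.fst a b ≫ x) (pullback.snd a b) (by simp [h, pullback.condition])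
  have hz₁ : z ≫ pullback.fst b b = pullback.fst a b ≫ x := pullback.lift_fst _ _ _
  have hz₂ : z ≫ pullback.snd b b = pullback.snd a b := pullback.lift_snd _ _ _
  have right : IsPullback (pullback.fst a b) z x (pullback.fst b b) := by
    refine IsPullback.of_bot (v₂₁ := pullback.snd b b) (h₃₁ := b) (v₂₂ := b) ?_ hz₁.symm
      (IsPullback.of_hasPullback b b)
    rw [hz₂, h]
    exact IsPullback.of_hasPullback a b
  refine IsStableSystem.of_isPullback (snd := x) (f := z) ?_ hb
  -- Pasted with `right`, the square in question becomes one whose horizontal sides are identities.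
  refine IsPullback.of_right (h₁₂ := pullback.fst a b) (h₂₂ := pullback.fst b b) (v₁₃ := x) ?_ ?_
    right
  · simpa using IsPullback.of_horiz_isIso (fst := 𝟙 S) (snd := x) (f := x) (g := 𝟙 T) ⟨by simp⟩
  · apply pullback.hom_ext <;> simp [hz₁, hz₂]

end ThinImages

/-! ### Calculus of span classes -/

namespace SpanQ

variable {C : Type u} [Category.{v} C] [HasPullbacks C] {W : MorphismProperty C}
  [IsStableSystem W]

theorem hom_ind {A B : C} {p : ((⟨A⟩ : SpanQ W) ⟶ ⟨B⟩) → Prop}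
    (h : ∀ {X : C} (f : X ⟶ A) (g : X ⟶ B), p (bracket W f g)) (r : (⟨A⟩ : SpanQ W) ⟶ ⟨B⟩) : p r :=
  ind (fun S => h S.l S.r) r

theorem bracket_eq_of_mem {A B X Y : C} {f : X ⟶ A} {g : X ⟶ B} {h : Y ⟶ A} {k : Y ⟶ B}
    (x : X ⟶ Y) (hx : W x) (h₁ : x ≫ h = f) (h₂ : x ≫ k = g) : bracket W f g = bracket W h k :=
  cls_eq (S := sp f g) (T := sp h k) x hx h₁ h₂

/-- This links pullbacks in `C` with composites `g° · f` of graphs; it serves for kernel pairs and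
for the pullbacks behind 2-cells alike. -/
theorem graph_comp_bracket_id {A B D : C} {P : C} {p : P ⟶ A} {q : P ⟶ D} {f : A ⟶ B} {g : D ⟶ B}
    (sq : IsPullback p q f g) :
    bracket W (𝟙 A) f ≫ bracket W g (𝟙 D) = bracket W p q := by
  rw [bracket_comp_bracket _ _ _ _ sq, Category.comp_id, Category.comp_id]

theorem bracket_id_comp_graph {A B X : C} (f : X ⟶ A) (g : X ⟶ B) :
    bracket W f (𝟙 X) ≫ bracket W (𝟙 X) g = bracket W f g := by
  rw [bracket_comp_bracket _ _ _ _ (IsPullback.of_horiz_isIso (fst := 𝟙 X) (snd := 𝟙 X) ⟨rfl⟩),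
    Category.id_comp, Category.id_comp]

theorem graph_comp_graph {A B D : C} (f : A ⟶ B) (g : B ⟶ D) :
    bracket W (𝟙 A) f ≫ bracket W (𝟙 B) g = bracket W (𝟙 A) (f ≫ g) := by
  rw [bracket_comp_bracket _ _ _ _ (IsPullback.of_horiz_isIso (fst := 𝟙 A) (snd := f) ⟨by simp⟩),
    Category.id_comp]

variable [HasBinaryProducts C]

theorem conv_bracket {A B X : C} (f : X ⟶ A) (g : X ⟶ B) :
    conv (bracket W f g) = bracket W g f :=
  rfl

theorem meet_bracket {A B X Y P : C} {f : X ⟶ A} {g : X ⟶ B} {h : Y ⟶ A} {k : Y ⟶ B}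
    {p : P ⟶ X} {q : P ⟶ Y} (sq : IsPullback p q (prod.lift f g) (prod.lift h k)) :
    AllegoryOps.meet (bracket W f g) (bracket W h k) = bracket W (p ≫ f) (p ≫ g) := by
  let e := (IsPullback.of_hasPullback (prod.lift f g) (prod.lift h k)).isoIsPullback _ _ sq
  refine cls_eq_of_isIso (S := spanMeet (sp f g) (sp h k)) (T := sp (p ≫ f) (p ≫ g)) e.hom
    e.isIso_hom ?_ ?_
  · exact IsPullback.isoIsPullback_hom_fst_assoc _ _ _ sq _
  · exact IsPullback.isoIsPullback_hom_fst_assoc _ _ _ sq _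

variable (W) in
/-- The meet of two spans is their product as objects over `A × B`. -/
theorem exists_meet_bracket {A B X Y : C} (f : X ⟶ A) (g : X ⟶ B) (h : Y ⟶ A) (k : Y ⟶ B) :
    ∃ (P : C) (p : P ⟶ X) (q : P ⟶ Y), p ≫ f = q ≫ h ∧ p ≫ g = q ≫ k ∧
      AllegoryOps.meet (bracket W f g) (bracket W h k) = bracket W (p ≫ f) (p ≫ g) ∧
      ∀ {Z : C} (x : Z ⟶ X) (y : Z ⟶ Y), x ≫ f = y ≫ h → x ≫ g = y ≫ k →
        ∃ z : Z ⟶ P, z ≫ p = x ∧ z ≫ q = y := by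
  have sq := IsPullback.of_hasPullback (prod.lift f g) (prod.lift h k)
  refine ⟨_, _, _, ?_, ?_, meet_bracket sq, fun x y hx hy =>
    ⟨sq.lift x y (by apply Limits.prod.hom_ext <;> simp [hx, hy]), sq.lift_fst _ _ _,
      sq.lift_snd _ _ _⟩⟩
  · simpa using congrArg (· ≫ prod.fst) sq.w
  · simpa using congrArg (· ≫ prod.snd) sq.w

/-- The span representing the meet projects to `X`, and `(1, x)` is a section of this projection. By
`lift_id_mem` the section is in `W`, so it identifies `[f, g]` with the meet. -/
theorem le_of_diagonal_mem {A B X Y : C} {f : X ⟶ A} {g : X ⟶ B} {h : Y ⟶ A} {k : Y ⟶ B}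
    (x : X ⟶ Y) (h₁ : x ≫ h = f) (h₂ : x ≫ k = g) (hW : W (pullback.diagonal (prod.lift h k))) :
    Le (bracket W f g) (bracket W h k) := by
  have hx : x ≫ prod.lift h k = prod.lift f g := by
    apply Limits.prod.hom_ext <;> simp [h₁, h₂]
  refine (meet_bracket (IsPullback.of_hasPullback (prod.lift f g) (prod.lift h k))).trans
    (bracket_eq_of_mem _ (lift_id_mem x _ _ hx hW) ?_ ?_).symm <;> simp

/-! ### Thin representatives and the order on classes -/

variable [HasThinImages W]

omit [IsStableSystem W] in
variable (W) in
/-- Each span has the same class as a span for which the diagonal of the morphism to the product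
is in `W`. -/
theorem exists_thin {A B X : C} (f : X ⟶ A) (g : X ⟶ B) :
    ∃ (Y : C) (h : Y ⟶ A) (k : Y ⟶ B) (e : X ⟶ Y), W e ∧ e ≫ h = f ∧ e ≫ k = g ∧
      W (pullback.diagonal (prod.lift h k)) := by
  obtain ⟨Z, e, m, he, hm, fac⟩ := HasThinImages.exists_factorization (W := W) (prod.lift f g)
  refine ⟨Z, m ≫ prod.fst, m ≫ prod.snd, e, he, by simp [reassoc_of% fac],
    by simp [reassoc_of% fac], ?_⟩
  -- The type of the diagonal depends on the morphism, so the equation with `m` is substituted in a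
  -- general statement and not rewritten.
  have key : ∀ n : Z ⟶ A ⨯ B, n = m → W (pullback.diagonal n) := by
    rintro _ rfl
    exact hm
  exact key _ (by apply Limits.prod.hom_ext <;> simp)

/-- The morphism `x` need not be in `W`: replacing the target by a thin representative makes
`le_of_diagonal_mem` applicable. -/
theorem le_bracket {A B X Y : C} {f : X ⟶ A} {g : X ⟶ B} {h : Y ⟶ A} {k : Y ⟶ B}
    (x : X ⟶ Y) (h₁ : x ≫ h = f) (h₂ : x ≫ k = g) : Le (bracket W f g) (bracket W h k) := by
  obtain ⟨Z, h', k', e, he, e₁, e₂, hZ⟩ := exists_thin W h k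
  rw [bracket_eq_of_mem e he e₁ e₂]
  exact le_of_diagonal_mem (x ≫ e) (by simp [e₁, h₁]) (by simp [e₂, h₂]) hZ

-- A converse to `le_bracket` for suitable representatives: if `r ∧ s = r`, then `r` is represented
-- by the meet span, which projects to any span representing `s`.
omit [HasThinImages W] in
theorem exists_of_le {A B : C} {r s : (⟨A⟩ : SpanQ W) ⟶ ⟨B⟩} (hrs : Le r s) :
    ∃ (X Y : C) (f : X ⟶ A) (g : X ⟶ B) (h : Y ⟶ A) (k : Y ⟶ B) (x : X ⟶ Y),
      r = bracket W f g ∧ s = bracket W h k ∧ x ≫ h = f ∧ x ≫ k = g := by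
  induction r using hom_ind with
  | h f g =>
  induction s using hom_ind with
  | h h k =>
    obtain ⟨P, p, q, hp, hq, e, -⟩ := exists_meet_bracket W f g h k
    exact ⟨P, _, _, _, h, k, q, hrs.symm.trans e, rfl, hp.symm, hq.symm⟩

omit [HasThinImages W] in
theorem meet_bracket_comm {A B X Y : C} (f : X ⟶ A) (g : X ⟶ B) (h : Y ⟶ A) (k : Y ⟶ B) :
    AllegoryOps.meet (bracket W f g) (bracket W h k) =
      AllegoryOps.meet (bracket W h k) (bracket W f g) := by
  have sq := IsPullback.of_hasPullback (prod.lift f g) (prod.lift h k)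
  rw [meet_bracket sq, meet_bracket sq.flip]
  have h₁ := congrArg (· ≫ prod.fst) sq.w
  have h₂ := congrArg (· ≫ prod.snd) sq.w
  simp only [Category.assoc, prod.lift_fst, prod.lift_snd] at h₁ h₂
  rw [h₁, h₂]

/-- Antisymmetry of the order at the level of spans. It spares the equational laws any check of
membership in `W`. -/
theorem bracket_eq_of_homs {A B X Y : C} {f : X ⟶ A} {g : X ⟶ B} {h : Y ⟶ A} {k : Y ⟶ B}
    (x : X ⟶ Y) (y : Y ⟶ X) (h₁ : x ≫ h = f) (h₂ : x ≫ k = g) (h₃ : y ≫ f = h)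
    (h₄ : y ≫ g = k) : bracket W f g = bracket W h k :=
  (le_bracket x h₁ h₂).symm.trans ((meet_bracket_comm _ _ _ _).trans (le_bracket y h₃ h₄))

/-! ### The allegory laws -/

instance : IsAllegory (SpanQ W) where
  meet_self {A B} r := by
    induction r using hom_ind with
    | h f g => exact le_bracket (𝟙 _) (Category.id_comp _) (Category.id_comp _)
  meet_comm {A B} r s := by
    induction r using hom_ind with
    | h f g =>
    induction s using hom_ind with
    | h h k => exact meet_bracket_comm f g h k
  meet_assoc {A B} r s t := by
    induction r using hom_ind with
    | h f g =>
    induction s using hom_ind with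
    | h h k =>
    induction t using hom_ind with
    | h l m =>
      obtain ⟨P, p₁, p₂, hp₁, hp₂, hp, lift⟩ := exists_meet_bracket W f g h k
      obtain ⟨Q, q₁, q₂, hq₁, hq₂, hq, lift'⟩ := exists_meet_bracket W (p₁ ≫ f) (p₁ ≫ g) l m
      obtain ⟨P', p₁', p₂', hp₁', hp₂', hp', lift₁⟩ := exists_meet_bracket W h k l m
      obtain ⟨Q', q₁', q₂', hq₁', hq₂', hq', lift₁'⟩ :=
        exists_meet_bracket W f g (p₁' ≫ h) (p₁' ≫ k)
      rw [hp, hp', hq, hq']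
      -- `Q` and `Q'` are the two bracketings of the triple product over `A × B`; `y` and `y'` go
      -- back and forth between them, through `x` and `x'`.
      obtain ⟨x, hx, hx'⟩ := lift₁ (q₁ ≫ p₂) q₂ (by rw [← hq₁, hp₁, Category.assoc])
        (by rw [← hq₂, hp₂, Category.assoc])
      obtain ⟨y, hy, hy'⟩ := lift₁' (q₁ ≫ p₁) x (by rw [reassoc_of% hx, Category.assoc, hp₁])
        (by rw [reassoc_of% hx, Category.assoc, hp₂])
      obtain ⟨x', hx₁, hx₁'⟩ := lift q₁' (q₂' ≫ p₁') (by simpa using hq₁') (by simpa using hq₂')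
      obtain ⟨y', hy₁, hy₁'⟩ := lift' x' (q₂' ≫ p₂')
        (by rw [reassoc_of% hx₁, hq₁', hp₁', Category.assoc])
        (by rw [reassoc_of% hx₁, hq₂', hp₂', Category.assoc])
      refine bracket_eq_of_homs y y' ?_ ?_ ?_ ?_
      · simp [reassoc_of% hy]
      · simp [reassoc_of% hy]
      · rw [reassoc_of% hy₁, reassoc_of% hx₁]
      · rw [reassoc_of% hy₁, reassoc_of% hx₁]
  comp_mono {A B D} r r' s s' hr hs := by
    obtain ⟨X, X', f, g, f', g', x, rfl, rfl, hx₁, hx₂⟩ := exists_of_le hr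
    obtain ⟨Y, Y', h, k, h', k', y, rfl, rfl, hy₁, hy₂⟩ := exists_of_le hs
    have sq := IsPullback.of_hasPullback g h
    have sq' := IsPullback.of_hasPullback g' h'
    rw [bracket_comp_bracket _ _ _ _ sq, bracket_comp_bracket _ _ _ _ sq']
    refine le_bracket (sq'.lift (pullback.fst g h ≫ x) (pullback.snd g h ≫ y) ?_) ?_ ?_
    · simp [hx₂, hy₁, sq.w]
    · rw [sq'.lift_fst_assoc, Category.assoc, hx₁]
    · rw [sq'.lift_snd_assoc, Category.assoc, hy₂]
  conv_conv {A B} r := by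
    induction r using hom_ind with
    | h f g => rfl
  conv_id X := rfl
  conv_comp {A B D} r s := by
    induction r using hom_ind with
    | h f g =>
    induction s using hom_ind with
    | h h k =>
      have sq := IsPullback.of_hasPullback g h
      rw [bracket_comp_bracket _ _ _ _ sq, conv_bracket, conv_bracket, conv_bracket,
        bracket_comp_bracket _ _ _ _ sq.flip]
  conv_meet {A B} r s := by
    induction r using hom_ind with
    | h f g =>
    induction s using hom_ind with
    | h h k =>
      obtain ⟨P, p, q, hp₁, hp₂, hp, lift⟩ := exists_meet_bracket W f g h k
      obtain ⟨P', p', q', hp₁', hp₂', hp', lift'⟩ := exists_meet_bracket W g f k h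
      rw [hp, conv_bracket, conv_bracket, conv_bracket, hp']
      obtain ⟨x, hx, -⟩ := lift' p q hp₂ hp₁
      obtain ⟨y, hy, -⟩ := lift p' q' hp₂' hp₁'
      refine bracket_eq_of_homs x y ?_ ?_ ?_ ?_ <;> simp [reassoc_of% hx, reassoc_of% hy]
  modular {A B D} r s t := by
    induction r using hom_ind with
    | h f g =>
    induction s using hom_ind with
    | h h k =>
    induction t using hom_ind with
    | h l m =>
      have sq := IsPullback.of_hasPullback g h
      have sq₁ := IsPullback.of_hasPullback m k
      rw [bracket_comp_bracket _ _ _ _ sq, conv_bracket, bracket_comp_bracket _ _ _ _ sq₁]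
      obtain ⟨P, p, q, hp₁, hp₂, hp, -⟩ :=
        exists_meet_bracket W (pullback.fst g h ≫ f) (pullback.snd g h ≫ k) l m
      obtain ⟨P', p', q', hp₁', hp₂', hp', lift'⟩ :=
        exists_meet_bracket W f g (pullback.fst m k ≫ l) (pullback.snd m k ≫ h)
      rw [hp, hp']
      have sq₂ := IsPullback.of_hasPullback (p' ≫ g) h
      rw [bracket_comp_bracket _ _ _ _ sq₂]
      -- In terms of elements, `P` consists of triples `(a, b, c)` with `g a = h b`, `f a = l c` and
      -- `k b = m c`. The morphism of spans sends such a triple to `((a, (c, b)), b)`.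
      obtain ⟨x, hx, -⟩ := lift' (p ≫ pullback.fst g h)
        (sq₁.lift q (p ≫ pullback.snd g h) (by rw [Category.assoc, hp₂]))
        (by rw [sq₁.lift_fst_assoc, Category.assoc, hp₁])
        (by rw [sq₁.lift_snd_assoc, Category.assoc, Category.assoc, sq.w])
      refine le_bracket (sq₂.lift x (p ≫ pullback.snd g h) ?_) ?_ ?_
      · rw [reassoc_of% hx, Category.assoc, sq.w]
      · rw [sq₂.lift_fst_assoc, reassoc_of% hx]
      · rw [sq₂.lift_snd_assoc, Category.assoc]

/-! ### Graphs, tabulations and the unit -/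

theorem bracket_le_bracket {A B X Y : C} {f : X ⟶ A} {g : X ⟶ B} {h : Y ⟶ A} {k : Y ⟶ B}
    (x : X ⟶ Y) (h₁ : x ≫ h = f) (h₂ : x ≫ k = g) : bracket W f g ≤ bracket W h k :=
  le_bracket x h₁ h₂

theorem isMap_graph {A B : C} (f : A ⟶ B) : IsMap (bracket W (𝟙 A) f) where
  le_comp_conv := by
    rw [conv_bracket, graph_comp_bracket_id (IsPullback.of_hasPullback f f)]
    exact bracket_le_bracket (pullback.diagonal f) (by simp) (by simp)
  conv_comp_le := by
    rw [conv_bracket, bracket_id_comp_graph]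
    exact bracket_le_bracket f (by simp) (by simp)

/-- The meet `f° f ∧ g° g` maps to the kernel pair of `⟨f, g⟩`, since its points are pairs
identified by both legs. The diagonal into this kernel pair is in `W`, so the class of the kernel
pair is the identity. -/
theorem tabulates_bracket {A B X : C} (f : X ⟶ A) (g : X ⟶ B)
    (h : W (pullback.diagonal (prod.lift f g))) :
    Tabulates (bracket W (𝟙 X) f) (bracket W (𝟙 X) g) (bracket W f g) where
  isMap_left := isMap_graph f
  isMap_right := isMap_graph g
  eq := (bracket_id_comp_graph f g).symm
  inf_eq := by
    have sq := IsPullback.of_hasPullback (prod.lift f g) (prod.lift f g)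
    have e : 𝟙 _ = bracket W (pullback.fst (prod.lift f g) (prod.lift f g)) (pullback.snd _ _) :=
      bracket_eq_of_mem _ h (by simp) (by simp)
    refine le_antisymm ?_ (le_inf (isMap_graph f).1 (isMap_graph g).1)
    rw [conv_bracket, conv_bracket, graph_comp_bracket_id (IsPullback.of_hasPullback f f),
      graph_comp_bracket_id (IsPullback.of_hasPullback g g), e]
    obtain ⟨P, p, q, hp₁, hp₂, hp, -⟩ := exists_meet_bracket W (pullback.fst f f)
      (pullback.snd f f) (pullback.fst g g) (pullback.snd g g)
    refine le_of_eq_of_le hp (bracket_le_bracket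
      (sq.lift (p ≫ pullback.fst f f) (p ≫ pullback.snd f f) ?_) (sq.lift_fst _ _ _)
      (sq.lift_snd _ _ _))
    apply Limits.prod.hom_ext
    · simp [pullback.condition]
    · simp only [Category.assoc, prod.lift_snd]
      rw [reassoc_of% hp₁, reassoc_of% hp₂, pullback.condition]

/-- The tabulating maps can be taken to be graphs; this is what reduces statements about arbitrary
maps to morphisms of `C`. -/
theorem exists_graph_tabulation {A B : C} (r : (⟨A⟩ : SpanQ W) ⟶ ⟨B⟩) :
    ∃ (X : C) (f : X ⟶ A) (g : X ⟶ B),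
      Tabulates (bracket W (𝟙 X) f) (bracket W (𝟙 X) g) r := by
  induction r using hom_ind with
  | h f g =>
    obtain ⟨Y, h, k, e, he, h₁, h₂, hY⟩ := exists_thin W f g
    rw [bracket_eq_of_mem e he h₁ h₂]
    exact ⟨Y, h, k, tabulates_bracket h k hY⟩

theorem isUnitObj_of_isTerminal {T : C} (hT : IsTerminal T) : IsUnitObj (⟨T⟩ : SpanQ W) where
  le_id r := by
    induction r using hom_ind with
    | h f g => exact bracket_le_bracket f (by simp) (hT.hom_ext _ _)
  exists_le X := ⟨bracket W (𝟙 X.obj) (hT.from X.obj), (isMap_graph _).le_comp_conv⟩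

/-- Stated for an arbitrary product cone, so that it applies to the image of a product under a
functor. -/
theorem le_bracket_prod {A B P : C} {p : P ⟶ A} {q : P ⟶ B} (h : IsLimit (BinaryFan.mk p q))
    (r : (⟨A⟩ : SpanQ W) ⟶ ⟨B⟩) : r ≤ bracket W p q := by
  induction r using hom_ind with
  | h f g =>
    obtain ⟨l, h₁, h₂⟩ := BinaryFan.IsLimit.lift' h f g
    exact bracket_le_bracket l h₁ h₂

instance [HasTerminal C] : IsUTabAllegory (SpanQ W) where
  tabular r := by
    obtain ⟨X, f, g, h⟩ := exists_graph_tabulation r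
    exact ⟨⟨X⟩, _, _, h⟩
  unitary := ⟨⟨⊤_ C⟩, isUnitObj_of_isTerminal terminalIsTerminal⟩

end SpanQ

end SpanAllegory

namespace SpanAllegory

/-! ### Maps and naturality squares in an allegory -/

section Allegory

variable {A : Type u₁} [Category.{v₁} A] [AllegoryOps A] [IsAllegory A]
  {B : Type u₂} [Category.{v₂} B] [AllegoryOps B] [IsAllegory B]

theorem id_le_comp_conv_comp {X Y Z : A} {r : X ⟶ Y} {s : Y ⟶ Z} (hr : 𝟙 X ≤ r ≫ conv r)
    (hs : 𝟙 Y ≤ s ≫ conv s) : 𝟙 X ≤ (r ≫ s) ≫ conv (r ≫ s) :=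
  calc 𝟙 X ≤ r ≫ conv r := hr
    _ = r ≫ 𝟙 Y ≫ conv r := by simp
    _ ≤ r ≫ (s ≫ conv s) ≫ conv r := comp_le_comp le_rfl (comp_le_comp hs le_rfl)
    _ = (r ≫ s) ≫ conv (r ≫ s) := by simp [IsAllegory.conv_comp]

/-- If a map `h` is tabulated by `f` and `g`, then `f` is invertible and `f ≫ h = g` in the category
of maps. -/
theorem Tabulates.isIso_left {T X Y : MapCat A} {f : T ⟶ X} {g : T ⟶ Y} {h : X ⟶ Y}
    (ht : Tabulates f.hom g.hom h.hom) : IsIso f ∧ f ≫ h = g := by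
  -- As `h = 1° · h`, the tabulation exhibits `f` as the pullback of an identity along `h`.
  have sq : IsPullback f g h (𝟙 Y) := by
    refine Tabulates.isPullback ?_
    have e : h.hom ≫ conv (𝟙 Y : Y ⟶ Y).hom = h.hom :=
      (congrArg (h.hom ≫ ·) (IsAllegory.conv_id Y.obj)).trans (Category.comp_id _)
    rwa [e]
  exact ⟨sq.isIso_fst_of_isIso, by simpa using sq.w⟩

variable {R S : A ⥤ B}

/-- To show that the naturality squares of a transformation are pullbacks, it suffices to consider
maps that occur in a tabulation. -/
theorem isPullback_of_tabulates (hR : IsUnitaryRep R) (hS : IsUnitaryRep S) (φ : R ⟶ S)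
    (hφ : ∀ X, IsMap (φ.app X)) {T X Y : MapCat A} {f : T ⟶ X} {g : T ⟶ Y} {h : X ⟶ Y}
    (ht : Tabulates f.hom g.hom h.hom)
    (hg : IsPullback (hR.mapFunctor.map g)
      (⟨φ.app T.obj, hφ T.obj⟩ : hR.mapFunctor.obj T ⟶ hS.mapFunctor.obj T)
      (⟨φ.app Y.obj, hφ Y.obj⟩ : hR.mapFunctor.obj Y ⟶ hS.mapFunctor.obj Y)
      (hS.mapFunctor.map g)) :
    IsPullback (hR.mapFunctor.map h)
      (⟨φ.app X.obj, hφ X.obj⟩ : hR.mapFunctor.obj X ⟶ hS.mapFunctor.obj X)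
      (⟨φ.app Y.obj, hφ Y.obj⟩ : hR.mapFunctor.obj Y ⟶ hS.mapFunctor.obj Y)
      (hS.mapFunctor.map h) := by
  obtain ⟨hf, rfl⟩ := ht.isIso_left
  -- At the isomorphism `f⁻¹` the naturality square is a pullback for free; pasting it with the
  -- square at `g` gives the square at `h`.
  have sq : IsPullback (hR.mapFunctor.map (inv f))
      (⟨φ.app X.obj, hφ X.obj⟩ : hR.mapFunctor.obj X ⟶ hS.mapFunctor.obj X)
      (⟨φ.app T.obj, hφ T.obj⟩ : hR.mapFunctor.obj T ⟶ hS.mapFunctor.obj T)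
      (hS.mapFunctor.map (inv f)) :=
    IsPullback.of_horiz_isIso ⟨WideSubcategory.hom_ext _ (φ.naturality (inv f).hom)⟩
  have sq' := sq.paste_horiz hg
  rwa [← Functor.map_comp, ← Functor.map_comp, IsIso.inv_hom_id_assoc] at sq'

end Allegory

namespace SpanQ

variable {C : Type u} [Category.{v} C] [HasPullbacks C] {W : MorphismProperty C}
  [IsStableSystem W] [HasBinaryProducts C] [HasThinImages W]

/-- The legs of a pullback are jointly monic, so the diagonal of their pairing is invertible and in
particular in `W`. -/
theorem tabulates_of_isPullback {A B Z X : C} {p : X ⟶ A} {q : X ⟶ B} {f : A ⟶ Z} {g : B ⟶ Z}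
    (sq : IsPullback p q f g) :
    Tabulates (bracket W (𝟙 X) p) (bracket W (𝟙 X) q)
      (bracket W (𝟙 A) f ≫ conv (bracket W (𝟙 B) g)) := by
  rw [conv_bracket, graph_comp_bracket_id sq]
  refine tabulates_bracket p q (IsStableSystem.of_isIso _ ?_)
  have : Mono (prod.lift p q) := ⟨fun a b h => sq.hom_ext
    (by simpa [prod.lift_fst] using congrArg (· ≫ prod.fst) h)
    (by simpa [prod.lift_snd] using congrArg (· ≫ prod.snd) h)⟩
  infer_instance

end SpanQ

/-! ### Induced representations and 2-cells -/

section Induced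

variable {C : Type u₁} [Category.{v₁} C] [HasFiniteLimits C] {D : Type u₂} [Category.{v₂} D]
  [HasFiniteLimits D] {W : MorphismProperty C} [IsStableSystem W] {V : MorphismProperty D}
  [IsStableSystem V] [HasThinImages W] [HasThinImages V]

omit [HasThinImages W] [HasThinImages V] in
theorem spanFunctor_map_graph (F : C ⥤ D) [PreservesFiniteLimits F]
    (h : ∀ ⦃X Y : C⦄ (f : X ⟶ Y), W f → V (F.map f)) {X Y : C} (f : X ⟶ Y) :
    (spanFunctor F h).map (SpanQ.bracket W (𝟙 X) f) = SpanQ.bracket V (𝟙 (F.obj X)) (F.map f) := by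
  rw [spanFunctor_map_bracket, F.map_id]

omit [HasThinImages W] [HasThinImages V] in
theorem spanFunctor_map_conv (F : C ⥤ D) [PreservesFiniteLimits F]
    (h : ∀ ⦃X Y : C⦄ (f : X ⟶ Y), W f → V (F.map f)) {X Y : SpanQ W} (r : X ⟶ Y) :
    (spanFunctor F h).map (conv r) = conv ((spanFunctor F h).map r) := by
  induction r using SpanQ.hom_ind with
  | h f g => rfl

theorem spanFunctor_map_inf (F : C ⥤ D) [PreservesFiniteLimits F]
    (h : ∀ ⦃X Y : C⦄ (f : X ⟶ Y), W f → V (F.map f)) {X Y : SpanQ W} (r s : X ⟶ Y) :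
    (spanFunctor F h).map (r ⊓ s) = (spanFunctor F h).map r ⊓ (spanFunctor F h).map s := by
  induction r using SpanQ.hom_ind with
  | h f g =>
  induction s using SpanQ.hom_ind with
  | h l m =>
    have sq := IsPullback.of_hasPullback (prod.lift f g) (prod.lift l m)
    have key : ∀ {Z : C} (a : Z ⟶ X.obj) (b : Z ⟶ Y.obj),
        F.map (prod.lift a b) ≫ (PreservesLimitPair.iso F X.obj Y.obj).hom =
          prod.lift (F.map a) (F.map b) := by
      intro Z a b
      apply Limits.prod.hom_ext <;>
        simp [prod.lift_fst, prod.lift_snd, ← Functor.map_comp]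
    -- The image of the pullback lies over `F (A × B)`; the product comparison isomorphism carries
    -- it to a pullback over `F A × F B`, which computes the meet.
    have sq' : IsPullback (F.map (pullback.fst (prod.lift f g) (prod.lift l m)))
        (F.map (pullback.snd (prod.lift f g) (prod.lift l m)))
        (prod.lift (F.map f) (F.map g)) (prod.lift (F.map l) (F.map m)) :=
      (sq.map F).of_iso (Iso.refl _) (Iso.refl _) (Iso.refl _)
        (PreservesLimitPair.iso F X.obj Y.obj) (by simp) (by simp)
        ((key f g).trans (Category.id_comp _).symm) ((key l m).trans (Category.id_comp _).symm)
    refine (congrArg _ (SpanQ.meet_bracket sq)).trans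
      (Eq.trans ?_ (SpanQ.meet_bracket (W := V) sq').symm)
    rw [spanFunctor_map_bracket, F.map_comp, F.map_comp]

theorem spanFunctor_map_le (F : C ⥤ D) [PreservesFiniteLimits F]
    (h : ∀ ⦃X Y : C⦄ (f : X ⟶ Y), W f → V (F.map f)) {X Y : SpanQ W} {r s : X ⟶ Y}
    (hrs : r ≤ s) : (spanFunctor F h).map r ≤ (spanFunctor F h).map s := by
  rw [← inf_eq_left] at hrs ⊢
  rw [← spanFunctor_map_inf, hrs]

theorem isUnitaryRep_spanFunctor (F : C ⥤ D) [PreservesFiniteLimits F]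
    (h : ∀ ⦃X Y : C⦄ (f : X ⟶ Y), W f → V (F.map f)) : IsUnitaryRep (spanFunctor F h) where
  map_conv := spanFunctor_map_conv F h
  map_inf := spanFunctor_map_inf F h
  map_unit E hE := by
    constructor
    · intro r
      -- The projections of `E × E` form a span below the identity, and `F` takes it to the largest
      -- class of endomorphisms of `F E`.
      have lim : IsLimit (BinaryFan.mk (F.map (prod.fst : E.obj ⨯ E.obj ⟶ _)) (F.map prod.snd)) :=
        mapIsLimitOfPreservesOfIsLimit F _ _ (prodIsProd E.obj E.obj)
      have hle := spanFunctor_map_le F h (hE.le_id (SpanQ.bracket W prod.fst prod.snd))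
      rw [CategoryTheory.Functor.map_id] at hle
      exact (SpanQ.le_bracket_prod lim r).trans hle
    · intro X
      -- Not every object is in the image of `F`, so the required morphism to `F E` is made to pass
      -- through the image of the terminal object, which is terminal.
      obtain ⟨s, hs⟩ := hE.exists_le ⟨⊤_ C⟩
      have hs' := spanFunctor_map_le F h hs
      rw [CategoryTheory.Functor.map_id, Functor.map_comp, spanFunctor_map_conv] at hs'
      have hT : IsTerminal (F.obj (⊤_ C)) := IsTerminal.isTerminalObj F _ terminalIsTerminal
      exact ⟨_, id_le_comp_conv_comp
        (SpanQ.isMap_graph (W := V) (hT.from X.obj)).le_comp_conv hs'⟩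

theorem isMapCell_spanNatTrans {F G : C ⥤ D} [PreservesFiniteLimits F] [PreservesFiniteLimits G]
    (hF : ∀ ⦃X Y : C⦄ (f : X ⟶ Y), W f → V (F.map f))
    (hG : ∀ ⦃X Y : C⦄ (f : X ⟶ Y), W f → V (G.map f)) (θ : F ⟶ G)
    (hθ : ∀ ⦃X Y : C⦄ (f : X ⟶ Y), IsPullback (F.map f) (θ.app X) (θ.app Y) (G.map f)) :
    IsMapCell (isUnitaryRep_spanFunctor F hF) (isUnitaryRep_spanFunctor G hG)
      (spanNatTrans hF hG θ hθ) where
  app_isMap X := SpanQ.isMap_graph (θ.app X.obj)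
  isPullback {X Y} r := by
    obtain ⟨T, f, g, ht⟩ := SpanQ.exists_graph_tabulation r.hom
    let T' : MapCat (SpanQ W) := ⟨⟨T⟩⟩
    let f' : T' ⟶ X := ⟨_, ht.1⟩
    let g' : T' ⟶ Y := ⟨_, ht.2⟩
    refine isPullback_of_tabulates (f := f') (g := g') (isUnitaryRep_spanFunctor F hF)
      (isUnitaryRep_spanFunctor G hG) (spanNatTrans hF hG θ hθ)
      (fun X => SpanQ.isMap_graph (θ.app X.obj)) ht (Tabulates.isPullback ?_)
    -- At the graph of `g`, the naturality square comes from the naturality square of `θ` at `g`, a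
    -- pullback in `D`.
    have key := SpanQ.tabulates_of_isPullback (W := V) (hθ g)
    rw [← spanFunctor_map_graph F hF, ← spanFunctor_map_graph G hG] at key
    exact key

end Induced

/-! ### The strict 2-functor -/

/-- The coherence 2-cells of a strict 2-functor are `eqToHom`s; for `all` the objects involved agree
definitionally, so their components are identities. -/
theorem UTabAll.eqToHom_toNatTrans_app {A B : UTabAll.{v, u}} {R S : A ⟶ B} (h : R = S)
    (X : A.carrier) :
    (eqToHom h).toNatTrans.app X =
      eqToHom (congrArg (fun R : A ⟶ B => R.toFunctor.obj X) h) := by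
  subst h
  rfl

theorem UTabAll.hom_ext {A B : UTabAll.{v, u}} {R S : UTabAll.Hom A B}
    (h : R.toFunctor = S.toFunctor) : R = S := by
  cases R
  cases S
  cases h
  rfl

namespace StabFact

theorem hasThinImages_bullet (X : StabFact.{v, u}) : HasThinImages X.bullet :=
  hasThinImages_bulletClass X.isStableFactorizationSystem

attribute [local instance] hasThinImages_bullet

theorem isUnitaryRep_span {X Y : StabFact.{v, u}} (F : X ⟶ Y) : IsUnitaryRep (Hom.span F) :=
  isUnitaryRep_spanFunctor _ _

theorem isMapCell_span {X Y : StabFact.{v, u}} {F G : X ⟶ Y} (θ : F ⟶ G) :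
    IsMapCell (isUnitaryRep_span F) (isUnitaryRep_span G) (Hom₂.span θ) :=
  isMapCell_spanNatTrans _ _ _ _

/-- The strict 2-functor that sends a stable factorization system to its allegory of spans. -/
noncomputable def all : StrictPseudofunctor StabFact.{v, u} UTabAll.{max u v, u} :=
  StrictPseudofunctor.mk''
    { obj := fun X => { carrier := X.spanCat }
      map := fun F => { toFunctor := Hom.span F, isUnitaryRep := isUnitaryRep_span F }
      map₂ := fun θ => { toNatTrans := Hom₂.span θ, isMapCell := isMapCell_span θ }
      map₂_id := fun F => UTabAll.hom₂_ext fun A => rfl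
      map₂_comp := fun θ η => UTabAll.hom₂_ext fun A =>
        (SpanQ.graph_comp_graph (θ.toNatTrans.app A.obj) (η.toNatTrans.app A.obj)).symm
      -- Both functors agree definitionally on a class given by a span; the identities on either
      -- side are the `eqToHom`s required by `Functor.ext`.
      map_id := fun X => UTabAll.hom_ext <| CategoryTheory.Functor.ext (fun _ => rfl)
        fun A B r => by
          induction r using SpanQ.hom_ind with
          | h f g => exact eq_id_comp_comp_id _
      map_comp := fun F G => UTabAll.hom_ext <| CategoryTheory.Functor.ext (fun _ => rfl)
        fun A B r => by
          induction r using SpanQ.hom_ind with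
          | h f g => exact eq_id_comp_comp_id _
      map₂_whisker_left := fun F G G' θ => UTabAll.hom₂_ext fun A => by
        refine Eq.trans ?_ (congrArg₂ (· ≫ ·) (UTabAll.eqToHom_toNatTrans_app _ A).symm
          (congrArg₂ (· ≫ ·) rfl (UTabAll.eqToHom_toNatTrans_app _ A).symm))
        exact eq_id_comp_comp_id _
      map₂_whisker_right := fun θ G => UTabAll.hom₂_ext fun A => by
        refine Eq.trans ?_ (congrArg₂ (· ≫ ·) (UTabAll.eqToHom_toNatTrans_app _ A).symm
          (congrArg₂ (· ≫ ·) rfl (UTabAll.eqToHom_toNatTrans_app _ A).symm))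
        refine Eq.trans ?_ (eq_id_comp_comp_id _)
        -- The image of `[1, θ]` is `[G 1, G θ]`, so the only content is `G 1 = 1`.
        exact (spanFunctor_map_graph G.toFunctor G.map_bullet (θ.toNatTrans.app A.obj)).symm }

end StabFact

end SpanAllegory

theorem mainTheorem12 :
    ∃ (h₀ : ∀ X : StabFact.{v, u}, IsUTabAllegory X.spanCat)
      (h₁ : ∀ {X Y : StabFact.{v, u}} (F : X ⟶ Y), IsUnitaryRep F.span)
      (h₂ : ∀ {X Y : StabFact.{v, u}} {F G : X ⟶ Y} (θ : F ⟶ G),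
        IsMapCell (h₁ F) (h₁ G) θ.span)
      (All : StrictPseudofunctor StabFact.{v, u} UTabAll.{max u v, u}),
      All.toPrelaxFunctorStruct =
        { obj := fun X => { carrier := X.spanCat, isUTabAllegory := h₀ X }
          map := fun F => { toFunctor := F.span, isUnitaryRep := h₁ F }
          map₂ := fun θ => { toNatTrans := θ.span, isMapCell := h₂ θ } } := by
  have (X : StabFact.{v, u}) := X.hasThinImages_bullet
  exact ⟨fun _ => inferInstance, StabFact.isUnitaryRep_span, StabFact.isMapCell_span,
    StabFact.all, rfl⟩
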